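/- Let $L$ be a number of qubits, and let $g_2,\dots,g_L$ be independent, mutually commuting Hermitian Pauli operators on $L$ qubits (Pauli strings with a sign $\pm1$) generating a stabilizer group $\mathcal G=\langle g_2,\dots,g_L\rangle$ with $-\mathbb 1\notin\mathcal G$. Let $\bar X,\bar Z$ be Hermitian Pauli operators that commute with every $g_j$ and anticommute with each other, and put $\bar Y=i\bar X\bar Z$; thus $\bar X,\bar Y,\bar Z$ are logical operators of the $[[L,1]]$ stabilizer code with stabilizer group $\mathcal G$. Let $|\psi\rangle$ be a pure $L$-qubit state with one unit of magic encoded in this code, that is, a unit vector with $$\rho=|\psi\rangle\langle\psi|=\frac1{2^L}\Big(\mathbb 1+\frac{\bar Z-\bar Y}{\sqrt2}\Big)\prod_{j=2}^L(\mathbb 1+g_j).$$ For an operator $\sigma$ on a set of qubits let $$\tilde{\mathcal M}_2(\sigma)=-\log_2\frac{\sum_P\operatorname{Tr}[P\sigma]^4}{\sum_P\operatorname{Tr}[P\sigma]^2},$$ where $P$ runs over all Pauli strings with phase $+1$ on these qubits. A logical operator $\bar\sigma$ is called reducible to a set $A$ of qubits if there is $s\in\mathcal G$ such that $\bar\sigma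 s$ acts as the identity outside $A$. Let $A\subseteq\{1,\dots,L\}$ be any set of qubits, $B$ its complement, and $\rho_A=\operatorname{Tr}_B\rho$. Then the following three conditions are equivalent. (a) $\tilde{\mathcal M}_2(\rho_A)=\log_2(4/3)$. (b) All three logical operators $\bar X,\bar Y,\bar Z$ are reducible to $A$. (c) Magic is unitarily extractable from $A$: for an ancilla qubit $C$ in the state $|0\rangle$, there are a Clifford unitary $U_{AC}$ acting only on $A$ and $C$ and a pure stabilizer state $|\psi'\rangle$ of the $L$ qubits $AB$ such that $$(\mathbb 1_B\otimes U_{AC})\,|\psi\rangle\otimes|0\rangle_C=|\psi'\rangle_{AB}\otimes|T\rangle_C,\qquad |T\rangle=\frac{|0\rangle+e^{i\pi/4}|1\rangle}{\sqrt2}.$$ -/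

import Mathlib

open scoped Matrix

noncomputable section

namespace QubitMagic

/-- Operators on a register whose qubits are labelled by `κ`; the computational basis consists of
the bit strings `κ → Fin 2`. -/
abbrev Op (κ : Type*) := Matrix (κ → Fin 2) (κ → Fin 2) ℂ

/-- The matrices `1, X, Y, Z`, in this order. -/
def pauliMat : Fin 4 → Matrix (Fin 2) (Fin 2) ℂ :=
  ![1, !![0, 1; 1, 0], !![0, -Complex.I; Complex.I, 0], !![1, 0; 0, -1]]

variable {κ : Type*} [Fintype κ] [DecidableEq κ]

/-- The Pauli string with phase `+1`: the tensor product over all qubits `i` of the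
matrices `pauliMat (p i)`. -/
def pauliString (p : κ → Fin 4) : Op κ :=
  Matrix.of fun x y => ∏ i, pauliMat (p i) (x i) (y i)

/-- Membership in the Pauli group: a Pauli string times a power of the imaginary unit. -/
def IsPauli (M : Op κ) : Prop :=
  ∃ (k : ℕ) (p : κ → Fin 4), M = Complex.I ^ k • pauliString p

/-- The Hermitian elements of the Pauli group: Pauli strings with a sign. -/
def IsHermitianPauli (M : Op κ) : Prop :=
  ∃ p : κ → Fin 4, M = pauliString p ∨ M = -pauliString p

/-- A Pauli operator that acts as the identity on every qubit outside `A`. -/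
def IsPauliSupportedOn (A : Finset κ) (M : Op κ) : Prop :=
  ∃ (k : ℕ) (p : κ → Fin 4), (∀ i, i ∉ A → p i = 0) ∧ M = Complex.I ^ k • pauliString p

/-- Clifford unitaries: conjugation maps the Pauli group to itself. -/
def IsClifford (U : Op κ) : Prop :=
  U ∈ Matrix.unitaryGroup (κ → Fin 2) ℂ ∧ ∀ M : Op κ, IsPauli M → IsPauli (U * M * Uᴴ)

/-- The operator `U ⊗ 1` that acts as `U` on the qubits in `S` and trivially on all others. -/
def localOp (S : Finset κ) (U : Op S) : Op κ :=
  Matrix.of fun x y => if ∀ i, i ∉ S → x i = y i then U (fun i => x i) (fun i => y i) else 0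

/-- The bit string that is `x` on `S` and `z` outside `S`. -/
def glue (S : Finset κ) (x : S → Fin 2) (z : {i // i ∉ S} → Fin 2) : κ → Fin 2 :=
  fun i => if h : i ∈ S then x ⟨i, h⟩ else z ⟨i, h⟩

/-- The reduced operator on `S`: the partial trace over the qubits outside `S`. -/
def reduced (S : Finset κ) (ρ : Op κ) : Op S :=
  Matrix.of fun x y => ∑ z : {i // i ∉ S} → Fin 2, ρ (glue S x z) (glue S y z)

/-- The density operator `|ψ⟩⟨ψ|`. -/
def density (ψ : (κ → Fin 2) → ℂ) : Op κ := Matrix.vecMulVec ψ (star ψ)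

/-- The (normalized) stabilizer 2-Rényi entropy
`-log₂ (∑_P Tr[Pρ]^4 / ∑_P Tr[Pρ]^2)`, the sums running over all Pauli strings with phase `+1`.
The traces are real for Hermitian `ρ`. -/
def stabilizerEntropy (ρ : Op κ) : ℝ :=
  -Real.logb 2 ((∑ p : κ → Fin 4, (Matrix.trace (pauliString p * ρ)).re ^ 4) /
    (∑ p : κ → Fin 4, (Matrix.trace (pauliString p * ρ)).re ^ 2))

/-- The product `∏ j, (1 + g j)` (in increasing order of `j`; the factors commute in all uses). -/
def stabProd {m : ℕ} (g : Fin m → Op κ) : Op κ := (List.ofFn fun j => 1 + g j).prod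

/-- Pure stabilizer states: unit vectors `φ` with `|φ⟩⟨φ| = ∏ j, (1 + s j) / 2` for `n` commuting
Hermitian Pauli operators `s j`, where `n` is the number of qubits. (The right-hand side has
trace one only if the `s j` are independent and do not generate `-1`.) -/
def IsStabilizerState (φ : (κ → Fin 2) → ℂ) : Prop :=
  star φ ⬝ᵥ φ = 1 ∧
  ∃ s : Fin (Fintype.card κ) → Op κ,
    (∀ j, IsHermitianPauli (s j)) ∧ (∀ i j, Commute (s i) (s j)) ∧
    density φ = ((2 : ℂ) ^ Fintype.card κ)⁻¹ • stabProd s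

/-- An `[[L, 1]]` stabilizer code with a choice of generators and of logical operators. -/
structure Code (L : ℕ) where
  /-- the stabilizer generators -/
  gen : Fin (L - 1) → Op (Fin L)
  /-- the logical operator `X̄` -/
  logX : Op (Fin L)
  /-- the logical operator `Z̄` -/
  logZ : Op (Fin L)
  gen_pauli : ∀ j, IsHermitianPauli (gen j)
  gen_commute : ∀ i j, Commute (gen i) (gen j)
  /-- the generators are independent -/
  gen_indep : ∀ j, gen j ∉ Submonoid.closure (gen '' {i | i ≠ j})
  neg_one_notMem : -1 ∉ Submonoid.closure (Set.range gen)
  logX_pauli : IsHermitianPauli logX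
  logZ_pauli : IsHermitianPauli logZ
  logX_commute : ∀ j, Commute logX (gen j)
  logZ_commute : ∀ j, Commute logZ (gen j)
  anticomm : logX * logZ = -(logZ * logX)

namespace Code

variable {L : ℕ}

/-- The logical operator `Ȳ = i X̄ Z̄`. -/
def logY (K : Code L) : Op (Fin L) := Complex.I • (K.logX * K.logZ)

/-- The stabilizer group. The generators square to `1`, so the monoid that they generate
is a group. -/
def stabGroup (K : Code L) : Submonoid (Op (Fin L)) := Submonoid.closure (Set.range K.gen)

/-- A logical operator is reducible to `A` if multiplication by some stabilizer makes it
supported on `A`. -/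
def Reducible (K : Code L) (A : Finset (Fin L)) (M : Op (Fin L)) : Prop :=
  ∃ s ∈ K.stabGroup, IsPauliSupportedOn A (M * s)

/-- The unit vector `ψ` is a state with one unit of magic encoded in the code:
`|ψ⟩⟨ψ| = 2^{-L} (1 + (Z̄ - Ȳ)/√2) ∏ j, (1 + g j)`. -/
def IsOneUnitState (K : Code L) (ψ : (Fin L → Fin 2) → ℂ) : Prop :=
  star ψ ⬝ᵥ ψ = 1 ∧
  density ψ = ((2 : ℂ) ^ L)⁻¹ •
    ((1 + ((Real.sqrt 2 : ℝ) : ℂ)⁻¹ • (K.logZ - K.logY)) * stabProd K.gen)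

end Code

/-- `|0⟩` -/
def ketZero : Fin 2 → ℂ := ![1, 0]

/-- The magic state `|T⟩ = (|0⟩ + e^{iπ/4} |1⟩)/√2`. -/
def ketT : Fin 2 → ℂ :=
  ((Real.sqrt 2 : ℝ) : ℂ)⁻¹ • ![1, Complex.exp (Complex.I * Real.pi / 4)]

/-- The state `ψ ⊗ χ` of the `L` qubits `some i` together with the ancilla qubit `none`. -/
def withAncilla {L : ℕ} (ψ : (Fin L → Fin 2) → ℂ) (χ : Fin 2 → ℂ) :
    (Option (Fin L) → Fin 2) → ℂ :=
  fun x => ψ (fun i => x (some i)) * χ (x none)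

/-- Magic is unitarily extractable from `A`: a Clifford unitary on the qubits of `A` and on an
ancilla in `|0⟩` produces `|T⟩` on the ancilla and leaves a stabilizer state on the `L` qubits. -/
def UnitarilyExtractable {L : ℕ} (A : Finset (Fin L)) (ψ : (Fin L → Fin 2) → ℂ) : Prop :=
  ∃ U : Op (Finset.insertNone A), IsClifford U ∧
    ∃ φ : (Fin L → Fin 2) → ℂ, IsStabilizerState φ ∧
      localOp (Finset.insertNone A) U *ᵥ withAncilla ψ ketZero = withAncilla φ ketT

end QubitMagic

end

/-!
In the encoded magic state, a Pauli string has expectation value `±1` if up to sign it is a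
stabilizer, `±1/√2` if up to sign it lies in one of the cosets `Z̄ 𝒢` and `Ȳ 𝒢`, and `0` otherwise.
If `g`, `z` and `y` count the strings of these three kinds that are supported on `A`, the second and
fourth moments of the expectation values on `A` are `g + (z + y) / 2` and `g + (z + y) / 4`, so the
entropy is `log₂ (4 / 3)` exactly if `z + y = 2 g`. Each of the two cosets has either no string on
`A` or as many as `𝒢`, hence this means that `Z̄` and `Ȳ`, and with them `X̄`, are reducible to `A`.

If `a = Z̄ s` and `b = -Ȳ t` are supported on `A`, with `s` and `t` in `𝒢`, then the state is fixed
by `(a + b) / √2`: it is a `T` state of the virtual qubit on which the anticommuting involutions `a`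
and `b` act as `X` and `Y`. The controlled-sign gate of the commuting involutions `a ⊗ X` and
`b ⊗ Y` is a Clifford gate that exchanges this virtual qubit with the ancilla.

Conversely, conjugation by a Clifford gate permutes the Pauli strings up to sign, so it preserves
the even moments. The moments are multiplicative over the ancilla, and a stabilizer state has equal
second and fourth moments because its expectation values lie in `{0, 1, -1}`. The moments of
`|0⟩` and `|T⟩` therefore determine the ratio of the moments of the encoded magic state.
-/

namespace QubitMagic

/-! ## Pauli strings -/

section PauliMat

theorem pauliMat_zero : pauliMat 0 = 1 := rfl

/-- The exponent of the imaginary unit in the product of two of the matrices `1, X, Y, Z`. -/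
def pauliPhase : Fin 4 → Fin 4 → ℕ :=
  ![![0, 0, 0, 0], ![0, 0, 1, 3], ![0, 3, 0, 1], ![0, 1, 3, 0]]

-- Up to phases, `1, X, Y, Z` form a Klein four-group, and the labels `00, 01, 10, 11` are added
-- bitwise in it.
theorem pauliMat_mul (a b : Fin 4) :
    pauliMat a * pauliMat b = Complex.I ^ pauliPhase a b • pauliMat (a ^^^ b) := by
  have xor_eq : a ^^^ b = (![![0, 1, 2, 3], ![1, 0, 3, 2], ![2, 3, 0, 1], ![3, 2, 1, 0]] :
      Fin 4 → Fin 4 → Fin 4) a b := by revert a b; decide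
  rw [xor_eq]
  fin_cases a <;> fin_cases b <;> ext i j <;> fin_cases i <;> fin_cases j <;>
    simp [pauliMat, pauliPhase, Matrix.mul_apply, Fin.sum_univ_two]

theorem pauliMat_mul_self (a : Fin 4) : pauliMat a * pauliMat a = 1 := by
  have phase_eq : pauliPhase a a = 0 := by revert a; decide
  have xor_eq : a ^^^ a = 0 := by revert a; decide
  rw [pauliMat_mul, phase_eq, xor_eq, pauliMat_zero, pow_zero, one_smul]

theorem pauliMat_conjTranspose (a : Fin 4) : (pauliMat a)ᴴ = pauliMat a := by
  fin_cases a <;> ext i j <;> fin_cases i <;> fin_cases j <;> simp [pauliMat]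

theorem trace_pauliMat (a : Fin 4) : (pauliMat a).trace = if a = 0 then 2 else 0 := by
  fin_cases a <;> simp [pauliMat, Matrix.trace, Fin.sum_univ_two]

end PauliMat

section Tensor

variable {κ : Type*} [Fintype κ]

/-- The tensor product of one-qubit operators, one for each qubit of the register. -/
def tensor (M : κ → Matrix (Fin 2) (Fin 2) ℂ) : Op κ :=
  Matrix.of fun x y => ∏ i, M i (x i) (y i)

theorem pauliString_eq_tensor (p : κ → Fin 4) : pauliString p = tensor fun i => pauliMat (p i) :=
  rfl

theorem tensor_smul (c : κ → ℂ) (M : κ → Matrix (Fin 2) (Fin 2) ℂ) :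
    tensor (fun i => c i • M i) = (∏ i, c i) • tensor M := by
  ext x y
  simp [tensor, Finset.prod_mul_distrib]

theorem tensor_conjTranspose (M : κ → Matrix (Fin 2) (Fin 2) ℂ) :
    (tensor M)ᴴ = tensor fun i => (M i)ᴴ := by
  ext x y
  simp [tensor, Matrix.conjTranspose_apply]

theorem tensor_one : tensor (fun _ : κ => 1) = 1 := by
  classical
  ext x y
  simp only [tensor, Matrix.of_apply, Matrix.one_apply, Finset.prod_ite_zero, Finset.mem_univ,
    forall_const, Finset.prod_const_one, funext_iff]

variable [DecidableEq κ]

theorem tensor_mul (M N : κ → Matrix (Fin 2) (Fin 2) ℂ) :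
    tensor M * tensor N = tensor fun i => M i * N i := by
  ext x y
  simp only [tensor, Matrix.mul_apply, Matrix.of_apply, ← Finset.prod_mul_distrib]
  rw [Finset.prod_univ_sum, Fintype.piFinset_univ]

theorem trace_tensor (M : κ → Matrix (Fin 2) (Fin 2) ℂ) :
    (tensor M).trace = ∏ i, (M i).trace := by
  simp only [tensor, Matrix.trace, Matrix.diag_apply, Matrix.of_apply]
  rw [Finset.prod_univ_sum, Fintype.piFinset_univ]

end Tensor

section PauliString

/-- The labels of the product of two Pauli strings, whose phase is forgotten. -/
def xorString {κ : Type*} (p q : κ → Fin 4) : κ → Fin 4 := fun i => p i ^^^ q i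

theorem xorString_right_injective {κ : Type*} (q : κ → Fin 4) :
    Function.Injective fun p : κ → Fin 4 => xorString p q := by
  have cancel : ∀ a b c : Fin 4, a ^^^ c = b ^^^ c → a = b := by decide
  exact fun p p' h => funext fun i => cancel _ _ _ (congrFun h i)

variable {κ : Type*} [Fintype κ]

theorem pauliString_zero : pauliString (0 : κ → Fin 4) = 1 := tensor_one

theorem pauliString_conjTranspose (p : κ → Fin 4) : (pauliString p)ᴴ = pauliString p := by
  simp only [pauliString_eq_tensor, tensor_conjTranspose, pauliMat_conjTranspose]

theorem pauliString_mul [DecidableEq κ] (p q : κ → Fin 4) :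
    ∃ k : ℕ, pauliString p * pauliString q = Complex.I ^ k • pauliString (xorString p q) := by
  refine ⟨∑ i, pauliPhase (p i) (q i), ?_⟩
  simp only [pauliString_eq_tensor, tensor_mul, pauliMat_mul, tensor_smul,
    Finset.prod_pow_eq_pow_sum, xorString]

theorem pauliString_mul_self [DecidableEq κ] (p : κ → Fin 4) :
    pauliString p * pauliString p = 1 := by
  simp only [pauliString_eq_tensor, tensor_mul, pauliMat_mul_self, tensor_one]

theorem pauliString_ne_zero (p : κ → Fin 4) : pauliString p ≠ 0 := by
  classical
  exact left_ne_zero_of_mul (pauliString_mul_self p ▸ one_ne_zero)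

theorem trace_pauliString_mul_of_ne [DecidableEq κ] {p q : κ → Fin 4} (h : p ≠ q) :
    (pauliString p * pauliString q).trace = 0 := by
  have xor_ne_zero : ∀ a b : Fin 4, a ≠ b → a ^^^ b ≠ 0 := by decide
  obtain ⟨k, hk⟩ := pauliString_mul p q
  obtain ⟨i, hi⟩ := Function.ne_iff.1 h
  have trace_at_i : (pauliMat (xorString p q i)).trace = 0 := by
    rw [trace_pauliMat, xorString, if_neg (xor_ne_zero _ _ hi)]
  rw [hk, Matrix.trace_smul, pauliString_eq_tensor, trace_tensor,
    Finset.prod_eq_zero (Finset.mem_univ i) trace_at_i, smul_zero]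

theorem eq_of_pauliString_eq_smul {p q : κ → Fin 4} {c : ℂ}
    (h : pauliString p = c • pauliString q) : p = q := by
  classical
  by_contra hne
  have trace_zero := trace_pauliString_mul_of_ne (Ne.symm hne)
  have c_eq_zero : c = 0 := by
    rw [h, mul_smul_comm, pauliString_mul_self, Matrix.trace_smul, Matrix.trace_one] at trace_zero
    simpa using trace_zero
  exact pauliString_ne_zero p (by rw [h, c_eq_zero, zero_smul])

end PauliString

/-! ## The Pauli group -/

section IsPauli

theorem I_pow_cases (k : ℕ) : Complex.I ^ k = 1 ∨ Complex.I ^ k = Complex.I ∨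
    Complex.I ^ k = -1 ∨ Complex.I ^ k = -Complex.I := by
  induction k with
  | zero => simp
  | succ k ih =>
    rw [pow_succ]
    rcases ih with h | h | h | h <;> simp [h]

section Phases

variable {κ : Type*} [Fintype κ]

theorem isPauli_pauliString (p : κ → Fin 4) : IsPauli (pauliString p) := ⟨0, p, by simp⟩

theorem IsPauli.I_pow_smul {M : Op κ} (hM : IsPauli M) (l : ℕ) :
    IsPauli (Complex.I ^ l • M) := by
  obtain ⟨k, p, rfl⟩ := hM
  exact ⟨l + k, p, by rw [smul_smul, pow_add]⟩

theorem IsPauli.neg {M : Op κ} (hM : IsPauli M) : IsPauli (-M) := by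
  simpa only [Complex.I_sq, neg_one_smul] using hM.I_pow_smul 2

theorem IsHermitianPauli.neg {M : Op κ} (hM : IsHermitianPauli M) : IsHermitianPauli (-M) := by
  obtain ⟨p, rfl | rfl⟩ := hM
  · exact ⟨p, Or.inr rfl⟩
  · exact ⟨p, Or.inl (neg_neg _)⟩

theorem IsHermitianPauli.isPauli {M : Op κ} (hM : IsHermitianPauli M) : IsPauli M := by
  obtain ⟨p, rfl | rfl⟩ := hM
  · exact isPauli_pauliString p
  · exact (isPauli_pauliString p).neg

theorem isHermitianPauli_one : IsHermitianPauli (1 : Op κ) := ⟨0, Or.inl pauliString_zero.symm⟩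

theorem IsHermitianPauli.conjTranspose_eq {M : Op κ} (hM : IsHermitianPauli M) : Mᴴ = M := by
  obtain ⟨p, rfl | rfl⟩ := hM <;> simp [pauliString_conjTranspose]

theorem IsPauli.isHermitianPauli {M : Op κ} (hM : IsPauli M) (h : Mᴴ = M) :
    IsHermitianPauli M := by
  obtain ⟨k, p, rfl⟩ := hM
  rw [Matrix.conjTranspose_smul, pauliString_conjTranspose] at h
  have phase_real : (Complex.I ^ k).im = 0 :=
    Complex.conj_eq_iff_im.1 (smul_left_injective ℂ (pauliString_ne_zero p) h)
  rcases I_pow_cases k with hk | hk | hk | hk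
  · exact ⟨p, Or.inl (by rw [hk, one_smul])⟩
  · simp [hk] at phase_real
  · exact ⟨p, Or.inr (by rw [hk, neg_one_smul])⟩
  · simp [hk] at phase_real

theorem IsPauliSupportedOn.I_pow_smul {A : Finset κ} {M : Op κ} (hM : IsPauliSupportedOn A M)
    (l : ℕ) : IsPauliSupportedOn A (Complex.I ^ l • M) := by
  obtain ⟨k, p, hp, rfl⟩ := hM
  exact ⟨l + k, p, hp, by rw [smul_smul, pow_add]⟩

theorem IsPauliSupportedOn.neg {A : Finset κ} {M : Op κ} (hM : IsPauliSupportedOn A M) :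
    IsPauliSupportedOn A (-M) := by
  simpa only [Complex.I_sq, neg_one_smul] using hM.I_pow_smul 2

end Phases

variable {κ : Type*} [Fintype κ] [DecidableEq κ]

theorem IsPauli.mul {M N : Op κ} (hM : IsPauli M) (hN : IsPauli N) : IsPauli (M * N) := by
  obtain ⟨k, p, rfl⟩ := hM
  obtain ⟨l, q, rfl⟩ := hN
  obtain ⟨m, hm⟩ := pauliString_mul p q
  refine ⟨k + l + m, xorString p q, ?_⟩
  rw [smul_mul_smul_comm, hm, smul_smul, pow_add, pow_add]

theorem IsHermitianPauli.mul_self {M : Op κ} (hM : IsHermitianPauli M) : M * M = 1 := by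
  obtain ⟨p, rfl | rfl⟩ := hM <;> simp [pauliString_mul_self]

theorem IsHermitianPauli.mul_of_commute {M N : Op κ} (hM : IsHermitianPauli M)
    (hN : IsHermitianPauli N) (h : Commute M N) : IsHermitianPauli (M * N) := by
  refine (hM.isPauli.mul hN.isPauli).isHermitianPauli ?_
  rw [Matrix.conjTranspose_mul, hM.conjTranspose_eq, hN.conjTranspose_eq, h.eq]

theorem IsHermitianPauli.I_smul_mul_of_anticommute {M N : Op κ} (hM : IsHermitianPauli M)
    (hN : IsHermitianPauli N) (h : M * N = -(N * M)) : IsHermitianPauli (Complex.I • (M * N)) := by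
  have isPauli : IsPauli (Complex.I • (M * N)) := by
    simpa only [pow_one] using (hM.isPauli.mul hN.isPauli).I_pow_smul 1
  refine isPauli.isHermitianPauli ?_
  rw [Matrix.conjTranspose_smul, Matrix.conjTranspose_mul, hM.conjTranspose_eq,
    hN.conjTranspose_eq, h, smul_neg, ← neg_smul]
  congr 1
  exact Complex.conj_I

theorem IsPauli.commute_or_anticommute {M N : Op κ} (hM : IsPauli M) (hN : IsPauli N) :
    M * N = N * M ∨ M * N = -(N * M) := by
  obtain ⟨k, p, rfl⟩ := hM
  obtain ⟨l, q, rfl⟩ := hN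
  suffices pauliString p * pauliString q = pauliString q * pauliString p ∨
      pauliString p * pauliString q = -(pauliString q * pauliString p) by
    simp only [smul_mul_smul_comm, mul_comm (Complex.I ^ l), ← smul_neg]
    exact this.imp (congrArg _) (congrArg _)
  obtain ⟨m, hpq⟩ := pauliString_mul p q
  have hqp : pauliString q * pauliString p =
      star (Complex.I ^ m) • pauliString (xorString p q) := by
    simpa only [Matrix.conjTranspose_mul, Matrix.conjTranspose_smul, pauliString_conjTranspose]
      using congrArg Matrix.conjTranspose hpq
  rw [hpq, hqp]
  rcases I_pow_cases m with hm | hm | hm | hm <;> simp [hm]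

theorem IsPauli.eq_of_trace_ne_zero {M : Op κ} (hM : IsPauli M) {p : κ → Fin 4}
    (h : (pauliString p * M).trace ≠ 0) : ∃ k : ℕ, M = Complex.I ^ k • pauliString p := by
  obtain ⟨k, q, rfl⟩ := hM
  rw [mul_smul_comm, Matrix.trace_smul] at h
  have hpq : p = q := by
    by_contra hne
    exact h (by rw [trace_pauliString_mul_of_ne hne, smul_zero])
  exact ⟨k, by rw [hpq]⟩

theorem IsPauliSupportedOn.mul {A : Finset κ} {M N : Op κ} (hM : IsPauliSupportedOn A M)
    (hN : IsPauliSupportedOn A N) : IsPauliSupportedOn A (M * N) := by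
  obtain ⟨k, p, hp, rfl⟩ := hM
  obtain ⟨l, q, hq, rfl⟩ := hN
  obtain ⟨m, hm⟩ := pauliString_mul p q
  refine ⟨k + l + m, xorString p q, fun i hi => ?_, ?_⟩
  · rw [xorString, hp i hi, hq i hi]; rfl
  · rw [smul_mul_smul_comm, hm, smul_smul, pow_add, pow_add]

end IsPauli

/-! ## Operators on part of the register -/

section LocalOp

open scoped Kronecker

section Register

variable {κ : Type*} [DecidableEq κ]

/-- A bit string on the register is a pair of bit strings, one on `S` and one outside `S`. -/
def splitEquiv (S : Finset κ) :
    (κ → Fin 2) ≃ (S → Fin 2) × ({i // i ∉ S} → Fin 2) :=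
  Equiv.piEquivPiSubtypeProd (· ∈ S) fun _ => Fin 2

variable [Fintype κ]

theorem localOp_eq_submatrix (S : Finset κ) (U : Op S) :
    localOp S U = (U ⊗ₖ (1 : Op {i // i ∉ S})).submatrix (splitEquiv S) (splitEquiv S) := by
  ext x y
  simp only [localOp, Matrix.of_apply, Matrix.submatrix_apply, Matrix.kroneckerMap_apply,
    Matrix.one_apply, splitEquiv, Equiv.piEquivPiSubtypeProd, Equiv.coe_fn_mk, funext_iff,
    Subtype.forall, mul_ite, mul_one, mul_zero]

/-- The embedding `U ↦ U ⊗ 1` of the operators on `S`, as a homomorphism of algebras. -/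
def localOpHom (S : Finset κ) : Op S →ₐ[ℂ] Op κ :=
  AlgHom.ofLinearMap
    { toFun := localOp S
      map_add' := fun U V => by
        simp only [localOp_eq_submatrix, Matrix.add_kronecker, Matrix.submatrix_add, Pi.add_apply]
      map_smul' := fun c U => by
        simp only [localOp_eq_submatrix, Matrix.smul_kronecker, Matrix.submatrix_smul,
          Pi.smul_apply, RingHom.id_apply] }
    (by simp [localOp_eq_submatrix])
    (fun U V => by
      simp only [LinearMap.coe_mk, AddHom.coe_mk, localOp_eq_submatrix,
        Matrix.submatrix_mul_equiv, ← Matrix.mul_kronecker_mul, mul_one])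

theorem localOpHom_apply (S : Finset κ) (U : Op S) : localOpHom S U = localOp S U := rfl

theorem localOp_mul (S : Finset κ) (U V : Op S) :
    localOp S (U * V) = localOp S U * localOp S V := map_mul (localOpHom S) U V

theorem localOp_neg (S : Finset κ) (U : Op S) : localOp S (-U) = -localOp S U :=
  map_neg (localOpHom S) U

theorem localOp_injective (S : Finset κ) : Function.Injective (localOp S) :=
  (localOpHom S).toRingHom.injective

theorem localOp_conjTranspose (S : Finset κ) (U : Op S) : localOp S Uᴴ = (localOp S U)ᴴ := by
  ext x y
  simp only [localOp, Matrix.of_apply, Matrix.conjTranspose_apply, eq_comm]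
  split_ifs <;> simp

theorem trace_mul_reduced (S : Finset κ) (M : Op S) (ρ : Op κ) :
    (M * reduced S ρ).trace = (localOp S M * ρ).trace := by
  set σ := ρ.submatrix (splitEquiv S).symm (splitEquiv S).symm with hσ
  have ρ_eq : ρ = σ.submatrix (splitEquiv S) (splitEquiv S) := by ext; simp [hσ]
  have reduced_apply (x y) : reduced S ρ x y = ∑ z, σ (x, z) (y, z) := rfl
  have trace_eq : (localOp S M * ρ).trace = ((M ⊗ₖ (1 : Op {i // i ∉ S})) * σ).trace := by
    rw [localOp_eq_submatrix, ρ_eq, Matrix.submatrix_mul_equiv]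
    exact Equiv.sum_comp (splitEquiv S) fun z => (_ * _ : Matrix _ _ ℂ) z z
  rw [trace_eq]
  simp only [Matrix.trace, Matrix.diag_apply, Matrix.mul_apply, reduced_apply,
    Fintype.sum_prod_type, Finset.mul_sum, Matrix.kroneckerMap_apply, Matrix.one_apply, mul_ite,
    mul_one, mul_zero, ite_mul, zero_mul, Finset.sum_ite_eq, Finset.mem_univ, if_true]
  exact Finset.sum_congr rfl fun x _ => Finset.sum_comm

end Register

section ExtString

variable {κ : Type*} [DecidableEq κ]

/-- The extension of the labels `p` of a Pauli string on `S` by identities outside `S`. -/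
def extString (S : Finset κ) (p : S → Fin 4) : κ → Fin 4 :=
  fun i => if h : i ∈ S then p ⟨i, h⟩ else 0

theorem extString_zero (S : Finset κ) : extString S 0 = 0 := by
  funext i
  simp [extString]

theorem extString_restrict {S : Finset κ} {p : κ → Fin 4} (hp : ∀ i, i ∉ S → p i = 0) :
    extString S (fun i => p i) = p := by
  funext i
  by_cases hi : i ∈ S <;> simp [extString, hi, hp]

theorem extString_xorString (S : Finset κ) (p q : S → Fin 4) :
    extString S (xorString p q) = xorString (extString S p) (extString S q) := by
  funext i
  by_cases h : i ∈ S <;> simp [extString, xorString, h]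

variable [Fintype κ]

theorem localOp_pauliString (S : Finset κ) (p : S → Fin 4) :
    localOp S (pauliString p) = pauliString (extString S p) := by
  ext x y
  have prod_inside : ∏ i ∈ S, pauliMat (extString S p i) (x i) (y i) =
      ∏ i : S, pauliMat (p i) (x i) (y i) := by
    rw [← Finset.prod_coe_sort]
    exact Finset.prod_congr rfl fun i _ => by simp [extString]
  have prod_outside : ∏ i ∈ Sᶜ, pauliMat (extString S p i) (x i) (y i) =
      if ∀ i, i ∉ S → x i = y i then 1 else 0 := by
    have factor : ∀ i ∈ Sᶜ, pauliMat (extString S p i) (x i) (y i) =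
        if x i = y i then 1 else 0 := fun i hi => by
      simp [extString, Finset.mem_compl.1 hi, pauliMat, Matrix.one_apply]
    simp only [Finset.prod_congr rfl factor, Finset.prod_ite_zero, Finset.mem_compl,
      Finset.prod_const_one]
  simp only [localOp, pauliString, Matrix.of_apply]
  rw [← Finset.prod_mul_prod_compl S, prod_inside, prod_outside]
  split_ifs <;> simp

theorem isPauliSupportedOn_of_eq_extString {S : Finset κ} {M : Op κ} {k : ℕ} {p : S → Fin 4}
    (h : M = Complex.I ^ k • pauliString (extString S p)) : IsPauliSupportedOn S M :=
  ⟨k, extString S p, fun i hi => by simp [extString, hi], h⟩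

theorem IsHermitianPauli.exists_localOp_eq {S : Finset κ} {M : Op κ} (hM : IsHermitianPauli M)
    (hS : IsPauliSupportedOn S M) : ∃ N : Op S, IsHermitianPauli N ∧ localOp S N = M := by
  obtain ⟨k, p, hp, rfl⟩ := hS
  obtain ⟨r, hr⟩ := hM
  have hrp : r = p := by
    rcases hr with h | h
    · exact eq_of_pauliString_eq_smul h.symm
    · exact eq_of_pauliString_eq_smul (c := -Complex.I ^ k) (by rw [neg_smul, h, neg_neg])
  subst hrp
  have localOp_eq : localOp S (pauliString fun i => r i) = pauliString r := by
    rw [localOp_pauliString, extString_restrict hp]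
  rcases hr with h | h
  · exact ⟨_, ⟨_, Or.inl rfl⟩, by rw [localOp_eq, h]⟩
  · exact ⟨_, ⟨_, Or.inr rfl⟩, by rw [localOp_neg, localOp_eq, h]⟩

end ExtString

end LocalOp

/-! ## Expectation values -/

section ExpVal

variable {κ : Type*} [Fintype κ] [DecidableEq κ]

/-- The expectation value `⟨v|M|v⟩` of `M` in the state `v`. -/
def expVal (v : (κ → Fin 2) → ℂ) (M : Op κ) : ℂ := star v ⬝ᵥ M *ᵥ v

theorem trace_mul_density (v : (κ → Fin 2) → ℂ) (M : Op κ) :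
    (M * density v).trace = expVal v M := by
  rw [density, Matrix.mul_vecMulVec, Matrix.trace_vecMulVec, dotProduct_comm, expVal]

theorem trace_pauliString_mul_reduced (S : Finset κ) (p : S → Fin 4) (v : (κ → Fin 2) → ℂ) :
    (pauliString p * reduced S (density v)).trace = expVal v (pauliString (extString S p)) := by
  rw [trace_mul_reduced, localOp_pauliString, trace_mul_density]

theorem expVal_add (v : (κ → Fin 2) → ℂ) (M N : Op κ) :
    expVal v (M + N) = expVal v M + expVal v N := by
  simp [expVal, Matrix.add_mulVec]

theorem expVal_smul (v : (κ → Fin 2) → ℂ) (c : ℂ) (M : Op κ) :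
    expVal v (c • M) = c * expVal v M := by
  simp [expVal, Matrix.smul_mulVec]

theorem expVal_neg (v : (κ → Fin 2) → ℂ) (M : Op κ) : expVal v (-M) = -expVal v M := by
  rw [← neg_one_smul ℂ, expVal_smul, neg_one_mul]

theorem expVal_one (v : (κ → Fin 2) → ℂ) : expVal v 1 = star v ⬝ᵥ v := by
  rw [expVal, Matrix.one_mulVec]

theorem expVal_mulVec (v : (κ → Fin 2) → ℂ) (V M : Op κ) :
    expVal (V *ᵥ v) M = expVal v (Vᴴ * M * V) := by
  simp only [expVal, Matrix.star_mulVec, ← Matrix.mulVec_mulVec, Matrix.dotProduct_mulVec,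
    Matrix.vecMul_vecMul, Matrix.mul_assoc]

theorem expVal_mul_right_of_fixed {v : (κ → Fin 2) → ℂ} {N : Op κ} (h : N *ᵥ v = v)
    (M : Op κ) : expVal v (M * N) = expVal v M := by
  rw [expVal, ← Matrix.mulVec_mulVec, h, expVal]

theorem expVal_mul_left_of_fixed {v : (κ → Fin 2) → ℂ} {N : Op κ} (hN : Nᴴ = N)
    (h : N *ᵥ v = v) (M : Op κ) : expVal v (N * M) = expVal v M := by
  have star_fixed : star v ᵥ* N = star v := by rw [← hN, ← Matrix.star_mulVec, h]
  rw [expVal, ← Matrix.mulVec_mulVec, Matrix.dotProduct_mulVec, star_fixed, expVal]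

theorem two_mul_expVal_of_anticommutator {v : (κ → Fin 2) → ℂ} (hv : star v ⬝ᵥ v = 1)
    {M N : Op κ} {c : ℂ} (hN : Nᴴ = N) (hNv : N *ᵥ v = v) (h : N * M + M * N = c • 1) :
    2 * expVal v M = c := by
  have := congrArg (expVal v) h
  rwa [expVal_add, expVal_mul_left_of_fixed hN hNv, expVal_mul_right_of_fixed hNv, expVal_smul,
    expVal_one, hv, mul_one, ← two_mul] at this

theorem expVal_im_of_conjTranspose_eq (v : (κ → Fin 2) → ℂ) {M : Op κ} (hM : Mᴴ = M) :
    (expVal v M).im = 0 := by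
  rw [← Complex.conj_eq_iff_im]
  change star (star v ⬝ᵥ M *ᵥ v) = _
  rw [← Matrix.star_dotProduct, Matrix.star_mulVec, hM, ← Matrix.dotProduct_mulVec, expVal]

theorem expVal_pauliString_im (v : (κ → Fin 2) → ℂ) (p : κ → Fin 4) :
    (expVal v (pauliString p)).im = 0 :=
  expVal_im_of_conjTranspose_eq v (pauliString_conjTranspose p)

theorem expVal_pauliString_re_sq (v : (κ → Fin 2) → ℂ) (p : κ → Fin 4) :
    (expVal v (pauliString p)).re ^ 2 = ‖expVal v (pauliString p)‖ ^ 2 := by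
  rw [← sq_abs, Complex.abs_re_eq_norm.2 (expVal_pauliString_im v p)]

theorem density_mulVec_self {v : (κ → Fin 2) → ℂ} (hv : star v ⬝ᵥ v = 1) :
    density v *ᵥ v = v := by
  rw [density, Matrix.vecMulVec_mulVec, hv, MulOpposite.op_one, one_smul]

theorem mulVec_eq_of_mul_density {v : (κ → Fin 2) → ℂ} (hv : star v ⬝ᵥ v = 1) {N : Op κ}
    (h : N * density v = density v) : N *ᵥ v = v := by
  simpa only [← Matrix.mulVec_mulVec, density_mulVec_self hv] using congrArg (· *ᵥ v) h

theorem mulVec_eq_expVal_smul {v : (κ → Fin 2) → ℂ} (hv : star v ⬝ᵥ v = 1) {M : Op κ}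
    (h : Commute M (density v)) : M *ᵥ v = expVal v M • v := by
  calc M *ᵥ v = M *ᵥ density v *ᵥ v := by rw [density_mulVec_self hv]
    _ = density v *ᵥ M *ᵥ v := by rw [Matrix.mulVec_mulVec, h.eq, ← Matrix.mulVec_mulVec]
    _ = expVal v M • v := by rw [density, Matrix.vecMulVec_mulVec, op_smul_eq_smul, expVal]

theorem expVal_mul_of_commute_density {v : (κ → Fin 2) → ℂ} (hv : star v ⬝ᵥ v = 1) {M : Op κ}
    (h : Commute M (density v)) (N : Op κ) : expVal v (N * M) = expVal v N * expVal v M := by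
  rw [expVal, ← Matrix.mulVec_mulVec, mulVec_eq_expVal_smul hv h, Matrix.mulVec_smul,
    dotProduct_smul, smul_eq_mul, mul_comm]
  rfl

theorem density_mulVec (V : Op κ) (v : (κ → Fin 2) → ℂ) :
    density (V *ᵥ v) = V * density v * Vᴴ := by
  rw [density, density, Matrix.mul_vecMulVec, Matrix.vecMulVec_mul, Matrix.star_mulVec]

end ExpVal

/-! ## Stabilizer groups and codes -/

section StabProd

theorem mul_list_prod_one_add_eq_self {R : Type*} [Ring R] {g : R} (hg : g * g = 1) {l : List R}
    (hc : ∀ h ∈ l, Commute g h) (hgl : g ∈ l) :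
    g * (l.map (1 + ·)).prod = (l.map (1 + ·)).prod := by
  obtain ⟨l₁, l₂, rfl⟩ := List.append_of_mem hgl
  have comm_l₁ : Commute g (l₁.map (1 + ·)).prod := by
    refine Commute.list_prod_right _ _ fun x hx => ?_
    obtain ⟨h, hh, rfl⟩ := List.mem_map.1 hx
    exact (Commute.one_right g).add_right (hc h (List.mem_append_left _ hh))
  have absorb : g * (1 + g) = 1 + g := by rw [mul_add, mul_one, hg, add_comm]
  rw [List.map_append, List.map_cons, List.prod_append, List.prod_cons, ← mul_assoc, comm_l₁.eq,
    mul_assoc, ← mul_assoc g, absorb]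

variable {κ : Type*} [Fintype κ] [DecidableEq κ] {m : ℕ}

theorem stabProd_eq_prod_map (g : Fin m → Op κ) :
    stabProd g = ((List.ofFn g).map (1 + ·)).prod := by
  rw [List.map_ofFn]
  rfl

theorem stabProd_cons (c : Op κ) (g : Fin m → Op κ) :
    stabProd (Fin.cons c g : Fin (m + 1) → Op κ) = (1 + c) * stabProd g := by
  simp [stabProd, List.ofFn_succ]

theorem gen_mul_stabProd {g : Fin m → Op κ} (hg : ∀ j, IsHermitianPauli (g j))
    (hc : ∀ i j, Commute (g i) (g j)) (j : Fin m) : g j * stabProd g = stabProd g := by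
  rw [stabProd_eq_prod_map]
  refine mul_list_prod_one_add_eq_self (hg j).mul_self (fun h hh => ?_) (List.mem_ofFn.2 ⟨j, rfl⟩)
  obtain ⟨i, rfl⟩ := List.mem_ofFn.1 hh
  exact hc j i

theorem commute_stabProd {g : Fin m → Op κ} {M : Op κ} (h : ∀ j, Commute M (g j)) :
    Commute M (stabProd g) := by
  refine Commute.list_prod_right _ _ fun x hx => ?_
  obtain ⟨i, rfl⟩ := List.mem_ofFn.1 hx
  exact (Commute.one_right M).add_right (h i)

theorem stabProd_mem_span (g : Fin m → Op κ) :
    stabProd g ∈ Submodule.span ℂ (Submonoid.closure (Set.range g) : Set (Op κ)) := by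
  rw [← Algebra.adjoin_eq_span, Subalgebra.mem_toSubmodule]
  refine Subalgebra.list_prod_mem _ fun x hx => ?_
  obtain ⟨i, rfl⟩ := List.mem_ofFn.1 hx
  exact add_mem (one_mem _) (Algebra.subset_adjoin ⟨i, rfl⟩)

end StabProd

namespace Code

variable {L : ℕ} {K : Code L} {A : Finset (Fin L)} {M N s t : Op (Fin L)}

/-- The Hermitian Pauli operators that commute with the stabilizer group, i.e. the logical Pauli
operators of the code, stabilizers included. -/
structure IsLogicalPauli (K : Code L) (M : Op (Fin L)) : Prop where
  isHermitianPauli : IsHermitianPauli M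
  commute_gen : ∀ j, Commute M (K.gen j)

theorem isLogicalPauli_gen (K : Code L) (j : Fin (L - 1)) : K.IsLogicalPauli (K.gen j) :=
  ⟨K.gen_pauli j, K.gen_commute j⟩

theorem isLogicalPauli_one (K : Code L) : K.IsLogicalPauli 1 :=
  ⟨isHermitianPauli_one, fun j => Commute.one_left (K.gen j)⟩

theorem isLogicalPauli_logX (K : Code L) : K.IsLogicalPauli K.logX :=
  ⟨K.logX_pauli, K.logX_commute⟩

theorem isLogicalPauli_logZ (K : Code L) : K.IsLogicalPauli K.logZ :=
  ⟨K.logZ_pauli, K.logZ_commute⟩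

theorem IsLogicalPauli.neg (hM : K.IsLogicalPauli M) : K.IsLogicalPauli (-M) :=
  ⟨hM.isHermitianPauli.neg, fun j => (hM.commute_gen j).neg_left⟩

theorem IsLogicalPauli.mul_of_commute (hM : K.IsLogicalPauli M) (hN : K.IsLogicalPauli N)
    (h : Commute M N) : K.IsLogicalPauli (M * N) :=
  ⟨hM.isHermitianPauli.mul_of_commute hN.isHermitianPauli h,
    fun j => (hM.commute_gen j).mul_left (hN.commute_gen j)⟩

theorem IsLogicalPauli.I_smul_mul_of_anticommute (hM : K.IsLogicalPauli M)
    (hN : K.IsLogicalPauli N) (h : M * N = -(N * M)) :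
    K.IsLogicalPauli (Complex.I • (M * N)) :=
  ⟨hM.isHermitianPauli.I_smul_mul_of_anticommute hN.isHermitianPauli h,
    fun j => ((hM.commute_gen j).mul_left (hN.commute_gen j)).smul_left _⟩

theorem isLogicalPauli_logY (K : Code L) : K.IsLogicalPauli K.logY :=
  K.isLogicalPauli_logX.I_smul_mul_of_anticommute K.isLogicalPauli_logZ K.anticomm

theorem commute_of_mem_stabGroup (hM : ∀ j, Commute M (K.gen j)) (hs : s ∈ K.stabGroup) :
    Commute M s := by
  induction hs using Submonoid.closure_induction with
  | mem x hx => obtain ⟨j, rfl⟩ := hx; exact hM j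
  | one => exact Commute.one_right M
  | mul x y _ _ hx hy => exact hx.mul_right hy

theorem isLogicalPauli_of_mem_stabGroup (hs : s ∈ K.stabGroup) : K.IsLogicalPauli s := by
  induction hs using Submonoid.closure_induction with
  | mem x hx => obtain ⟨j, rfl⟩ := hx; exact K.isLogicalPauli_gen j
  | one => exact K.isLogicalPauli_one
  | mul x y _ hy hx hy' => exact hx.mul_of_commute hy' (commute_of_mem_stabGroup hx.commute_gen hy)

theorem IsLogicalPauli.commute_of_mem_stabGroup (hM : K.IsLogicalPauli M) (hs : s ∈ K.stabGroup) :
    Commute M s :=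
  Code.commute_of_mem_stabGroup hM.commute_gen hs

theorem IsLogicalPauli.mul_stabilizer (hM : K.IsLogicalPauli M) (hs : s ∈ K.stabGroup) :
    K.IsLogicalPauli (M * s) :=
  hM.mul_of_commute (isLogicalPauli_of_mem_stabGroup hs) (hM.commute_of_mem_stabGroup hs)

theorem IsLogicalPauli.mul_stabilizer_mul (hN : K.IsLogicalPauli N) (hs : s ∈ K.stabGroup)
    (M t : Op (Fin L)) : M * s * (N * t) = M * N * (s * t) :=
  (hN.commute_of_mem_stabGroup hs).symm.mul_mul_mul_comm M t

theorem mul_stabProd_of_mem_stabGroup (hs : s ∈ K.stabGroup) :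
    s * stabProd K.gen = stabProd K.gen := by
  induction hs using Submonoid.closure_induction with
  | mem x hx => obtain ⟨j, rfl⟩ := hx; exact gen_mul_stabProd K.gen_pauli K.gen_commute j
  | one => exact one_mul _
  | mul x y _ _ hx hy => rw [mul_assoc, hy, hx]

theorem Reducible.I_pow_smul (h : K.Reducible A M) (k : ℕ) :
    K.Reducible A (Complex.I ^ k • M) := by
  obtain ⟨s, hs, hA⟩ := h
  exact ⟨s, hs, by rw [smul_mul_assoc]; exact hA.I_pow_smul k⟩

theorem Reducible.mul (hM : K.Reducible A M) (hN : K.Reducible A N) (hNK : K.IsLogicalPauli N) :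
    K.Reducible A (M * N) := by
  obtain ⟨s, hs, hMs⟩ := hM
  obtain ⟨t, ht, hNt⟩ := hN
  exact ⟨s * t, mul_mem hs ht, by rw [← hNK.mul_stabilizer_mul hs]; exact hMs.mul hNt⟩

theorem logY_mul_logZ (K : Code L) : K.logY * K.logZ = Complex.I • K.logX := by
  rw [logY, smul_mul_assoc, mul_assoc, K.logZ_pauli.mul_self, mul_one]

theorem logZ_mul_logY (K : Code L) : K.logZ * K.logY = -(K.logY * K.logZ) := by
  rw [logY_mul_logZ, logY, mul_smul_comm, K.anticomm, mul_neg, ← mul_assoc,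
    K.logZ_pauli.mul_self, one_mul, smul_neg]

theorem Reducible.logX (hY : K.Reducible A K.logY) (hZ : K.Reducible A K.logZ) :
    K.Reducible A K.logX := by
  have logX_eq : K.logX = Complex.I ^ 3 • (K.logY * K.logZ) := by
    rw [K.logY_mul_logZ, smul_smul, ← pow_succ, Complex.I_pow_four, one_smul]
  rw [logX_eq]
  exact (hY.mul hZ K.isLogicalPauli_logZ).I_pow_smul 3

theorem pos (K : Code L) : 0 < L := by
  refine Nat.pos_of_ne_zero ?_
  rintro rfl
  have eq_one_or {M : Op (Fin 0)} (hM : IsHermitianPauli M) : M = 1 ∨ M = -1 := by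
    obtain ⟨p, hp⟩ := hM
    rwa [Subsingleton.elim p 0, pauliString_zero] at hp
  have one_eq_neg_one : (1 : Op (Fin 0)) = -1 := by
    have anticomm := K.anticomm
    rcases eq_one_or K.logX_pauli with hX | hX <;> rcases eq_one_or K.logZ_pauli with hZ | hZ <;>
      simpa only [hX, hZ, mul_one, one_mul, mul_neg, neg_mul, neg_neg, neg_eq_iff_eq_neg]
        using anticomm
  exact K.neg_one_notMem (one_eq_neg_one ▸ one_mem _)

end Code

/-! ## Moments of Pauli expectation values -/

section PauliMoment

variable {κ : Type*} [Fintype κ] [DecidableEq κ]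

/-- The sum of the `k`-th powers of the expectation values in the state `v` of all Pauli strings
on `S`. For `k = 2` and `k = 4` these are the two sums in the stabilizer entropy. -/
def pauliMoment (k : ℕ) (S : Finset κ) (v : (κ → Fin 2) → ℂ) : ℝ :=
  ∑ p : S → Fin 4, (expVal v (pauliString (extString S p))).re ^ k

theorem pauliMoment_pos {k : ℕ} (hk : Even k) (S : Finset κ) {v : (κ → Fin 2) → ℂ}
    (hv : star v ⬝ᵥ v = 1) : 0 < pauliMoment k S v := by
  refine Finset.sum_pos' (fun p _ => hk.pow_nonneg _) ⟨0, Finset.mem_univ _, ?_⟩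
  rw [extString_zero, pauliString_zero, expVal_one, hv, Complex.one_re, one_pow]
  exact one_pos

theorem stabilizerEntropy_reduced (S : Finset κ) (v : (κ → Fin 2) → ℂ) :
    stabilizerEntropy (reduced S (density v)) =
      Real.logb 2 (pauliMoment 2 S v / pauliMoment 4 S v) := by
  simp only [stabilizerEntropy, trace_pauliString_mul_reduced, ← Real.logb_inv, inv_div,
    pauliMoment]

theorem stabilizerEntropy_reduced_eq_logb_iff {S : Finset κ} {v : (κ → Fin 2) → ℂ}
    (hv : star v ⬝ᵥ v = 1) {c : ℝ} (hc : 0 < c) :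
    stabilizerEntropy (reduced S (density v)) = Real.logb 2 c ↔
      c * pauliMoment 4 S v = pauliMoment 2 S v := by
  have pos₂ := pauliMoment_pos (by decide : Even 2) S hv
  have pos₄ := pauliMoment_pos (by decide : Even 4) S hv
  rw [stabilizerEntropy_reduced, (Real.logb_injOn_pos one_lt_two).eq_iff (div_pos pos₂ pos₄) hc,
    div_eq_iff pos₄.ne', eq_comm]

theorem IsClifford.isHermitianPauli_conj {U : Op κ} (hU : IsClifford U) (p : κ → Fin 4) :
    IsHermitianPauli (U * pauliString p * Uᴴ) := by
  refine (hU.2 _ (isPauli_pauliString p)).isHermitianPauli ?_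
  rw [Matrix.conjTranspose_mul, Matrix.conjTranspose_mul, Matrix.conjTranspose_conjTranspose,
    pauliString_conjTranspose, mul_assoc]

theorem conjTranspose_mul_conj_mul {U : Op κ} (hU : Uᴴ * U = 1) (M : Op κ) :
    Uᴴ * (U * M * Uᴴ) * U = M := by
  rw [← mul_assoc, ← mul_assoc, hU, one_mul, mul_assoc, hU, mul_one]

theorem IsClifford.exists_perm {U : Op κ} (hU : IsClifford U) :
    ∃ π : Equiv.Perm (κ → Fin 4), ∀ p, U * pauliString p * Uᴴ = pauliString (π p) ∨
      U * pauliString p * Uᴴ = -pauliString (π p) := by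
  choose f hf using hU.isHermitianPauli_conj
  have f_injective : Function.Injective f := by
    intro p q hpq
    have conj_eq : ∃ c : ℂ, U * pauliString p * Uᴴ = c • (U * pauliString q * Uᴴ) := by
      have hp := hf p
      rw [hpq] at hp
      rcases hp with hp | hp <;> rcases hf q with hq | hq
      exacts [⟨1, by simp [hp, hq]⟩, ⟨-1, by simp [hp, hq]⟩, ⟨-1, by simp [hp, hq]⟩,
        ⟨1, by simp [hp, hq]⟩]
    obtain ⟨c, hc⟩ := conj_eq
    refine eq_of_pauliString_eq_smul (c := c) ?_
    rw [← conjTranspose_mul_conj_mul hU.1.1 (pauliString p), hc, mul_smul_comm, smul_mul_assoc,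
      conjTranspose_mul_conj_mul hU.1.1]
  exact ⟨Equiv.ofBijective f (Finite.injective_iff_bijective.1 f_injective), hf⟩

theorem IsClifford.pauliMoment_localOp_mulVec {S : Finset κ} {U : Op S} (hU : IsClifford U)
    {k : ℕ} (hk : Even k) (v : (κ → Fin 2) → ℂ) :
    pauliMoment k S (localOp S U *ᵥ v) = pauliMoment k S v := by
  obtain ⟨π, hπ⟩ := hU.exists_perm
  have expVal_conj (M : Op S) :
      expVal (localOp S U *ᵥ v) (localOp S (U * M * Uᴴ)) = expVal v (localOp S M) := by
    rw [expVal_mulVec, ← localOp_conjTranspose, ← localOp_mul, ← localOp_mul,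
      conjTranspose_mul_conj_mul hU.1.1]
  simp only [pauliMoment, ← localOp_pauliString]
  rw [← Equiv.sum_comp π]
  refine Finset.sum_congr rfl fun p _ => ?_
  rw [← expVal_conj (pauliString p)]
  rcases hπ p with h | h
  · rw [h]
  · rw [h, localOp_neg, expVal_neg, Complex.neg_re, hk.neg_pow]

end PauliMoment

/-! ## Encoded magic states -/

theorem inv_sqrt_two_mul_self : (√2 : ℂ)⁻¹ * (√2 : ℂ)⁻¹ = 2⁻¹ := by
  rw [← mul_inv, ← Complex.ofReal_mul, Real.mul_self_sqrt zero_le_two, Complex.ofReal_ofNat]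

theorem norm_inv_sqrt_two_sq : ‖(√2 : ℂ)⁻¹‖ ^ 2 = 1 / 2 := by
  rw [sq, ← norm_mul, inv_sqrt_two_mul_self]
  norm_num

namespace Code

open scoped Pointwise

variable {L : ℕ} {K : Code L} {A : Finset (Fin L)} {M s : Op (Fin L)} {ψ : (Fin L → Fin 2) → ℂ}

/-- The logical observable `(Z̄ - Ȳ)/√2` whose `+1` eigenstate is the encoded magic state. -/
noncomputable def logW (K : Code L) : Op (Fin L) := (√2 : ℂ)⁻¹ • (K.logZ - K.logY)

theorem logW_mul_self (K : Code L) : K.logW * K.logW = 1 := by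
  have square : (K.logZ - K.logY) * (K.logZ - K.logY) = (2 : ℂ) • 1 := by
    rw [sub_mul, mul_sub, mul_sub, K.logZ_pauli.mul_self,
      K.isLogicalPauli_logY.isHermitianPauli.mul_self, K.logZ_mul_logY, two_smul]
    abel
  rw [logW, smul_mul_smul_comm, inv_sqrt_two_mul_self, square, smul_smul,
    inv_mul_cancel₀ two_ne_zero, one_smul]

theorem logW_conjTranspose (K : Code L) : K.logWᴴ = K.logW := by
  rw [logW, Matrix.conjTranspose_smul, Matrix.conjTranspose_sub,
    K.isLogicalPauli_logY.isHermitianPauli.conjTranspose_eq, K.logZ_pauli.conjTranspose_eq]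
  simp

theorem commute_logW_of_mem_stabGroup (hs : s ∈ K.stabGroup) : Commute K.logW s :=
  ((K.isLogicalPauli_logZ.commute_of_mem_stabGroup hs).sub_left
    (K.isLogicalPauli_logY.commute_of_mem_stabGroup hs)).smul_left _

theorem logW_anticommutator_logZ (K : Code L) :
    K.logW * K.logZ + K.logZ * K.logW = (2 * (√2 : ℂ)⁻¹) • 1 := by
  rw [logW, smul_mul_assoc, mul_smul_comm, ← smul_add, sub_mul, mul_sub, K.logZ_pauli.mul_self,
    K.logZ_mul_logY, mul_comm, mul_smul, two_smul]
  abel_nf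

theorem logW_anticommutator_logY (K : Code L) :
    K.logW * K.logY + K.logY * K.logW = (2 * -(√2 : ℂ)⁻¹) • 1 := by
  rw [logW, smul_mul_assoc, mul_smul_comm, ← smul_add, sub_mul, mul_sub,
    K.isLogicalPauli_logY.isHermitianPauli.mul_self, K.logZ_mul_logY, mul_comm, neg_mul_comm,
    mul_smul, neg_smul, two_smul]
  abel_nf

namespace IsOneUnitState

theorem density_eq (hψ : K.IsOneUnitState ψ) :
    density ψ = ((2 : ℂ) ^ L)⁻¹ • ((1 + K.logW) * stabProd K.gen) := hψ.2

theorem logW_mulVec (hψ : K.IsOneUnitState ψ) : K.logW *ᵥ ψ = ψ := by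
  refine mulVec_eq_of_mul_density hψ.1 ?_
  rw [hψ.density_eq, mul_smul_comm, ← mul_assoc, mul_add, mul_one, K.logW_mul_self, add_comm]

theorem stab_mulVec (hψ : K.IsOneUnitState ψ) (hs : s ∈ K.stabGroup) : s *ᵥ ψ = ψ := by
  refine mulVec_eq_of_mul_density hψ.1 ?_
  have comm : Commute s (1 + K.logW) :=
    (Commute.one_right s).add_right (commute_logW_of_mem_stabGroup hs).symm
  rw [hψ.density_eq, mul_smul_comm, ← mul_assoc, comm.eq, mul_assoc,
    mul_stabProd_of_mem_stabGroup hs]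

theorem norm_expVal_logZ_sq (hψ : K.IsOneUnitState ψ) : ‖expVal ψ K.logZ‖ ^ 2 = 1 / 2 := by
  have expVal_eq := mul_left_cancel₀ two_ne_zero (two_mul_expVal_of_anticommutator hψ.1
    K.logW_conjTranspose hψ.logW_mulVec K.logW_anticommutator_logZ)
  rw [expVal_eq, norm_inv_sqrt_two_sq]

theorem norm_expVal_logY_sq (hψ : K.IsOneUnitState ψ) : ‖expVal ψ K.logY‖ ^ 2 = 1 / 2 := by
  have expVal_eq := mul_left_cancel₀ two_ne_zero (two_mul_expVal_of_anticommutator hψ.1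
    K.logW_conjTranspose hψ.logW_mulVec K.logW_anticommutator_logY)
  rw [expVal_eq, norm_neg, norm_inv_sqrt_two_sq]

theorem density_mem_span (hψ : K.IsOneUnitState ψ) :
    density ψ ∈ Submodule.span ℂ ({1, K.logZ, K.logY} * (K.stabGroup : Set (Op (Fin L)))) := by
  rw [hψ.density_eq, ← Submodule.span_mul_span]
  refine Submodule.smul_mem _ _ (Submodule.mul_mem_mul ?_ (stabProd_mem_span K.gen))
  refine add_mem (Submodule.subset_span (by simp)) (Submodule.smul_mem _ _ (sub_mem ?_ ?_)) <;>
    exact Submodule.subset_span (by simp)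

end IsOneUnitState

/-! ## Cosets of the stabilizer group on a subsystem -/

open Classical in
/-- The Pauli strings on `A` that belong, up to a phase, to the coset `M 𝒢` of the stabilizer
group. -/
noncomputable def cosetStrings (K : Code L) (A : Finset (Fin L)) (M : Op (Fin L)) :
    Finset (A → Fin 4) :=
  {p | ∃ s ∈ K.stabGroup, ∃ k : ℕ, M * s = Complex.I ^ k • pauliString (extString A p)}

theorem mem_cosetStrings {p : A → Fin 4} : p ∈ K.cosetStrings A M ↔
    ∃ s ∈ K.stabGroup, ∃ k : ℕ, M * s = Complex.I ^ k • pauliString (extString A p) := by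
  simp only [cosetStrings, Finset.mem_filter, Finset.mem_univ, true_and]

theorem reducible_of_cosetStrings_nonempty (h : (K.cosetStrings A M).Nonempty) :
    K.Reducible A M := by
  obtain ⟨p, hp⟩ := h
  obtain ⟨s, hs, k, hk⟩ := mem_cosetStrings.1 hp
  exact ⟨s, hs, isPauliSupportedOn_of_eq_extString hk⟩

theorem zero_mem_cosetStrings_one (K : Code L) (A : Finset (Fin L)) :
    0 ∈ K.cosetStrings A 1 :=
  mem_cosetStrings.2
    ⟨1, one_mem _, 0, by rw [extString_zero, pauliString_zero, pow_zero, one_smul, one_mul]⟩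

-- Multiplication by one element of `M 𝒢` on `A` maps all the others into `𝒢`.
theorem IsLogicalPauli.card_cosetStrings_le (hM : K.IsLogicalPauli M) (A : Finset (Fin L)) :
    (K.cosetStrings A M).card ≤ (K.cosetStrings A 1).card := by
  rcases (K.cosetStrings A M).eq_empty_or_nonempty with h | ⟨q, hq⟩
  · simp [h]
  obtain ⟨t, ht, l, hl⟩ := mem_cosetStrings.1 hq
  refine Finset.card_le_card_of_injOn (fun p => xorString p q) (fun p hp => ?_)
    (xorString_right_injective q).injOn
  obtain ⟨s, hs, k, hk⟩ := mem_cosetStrings.1 hp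
  obtain ⟨m, hm⟩ := pauliString_mul (extString A p) (extString A q)
  refine mem_cosetStrings.2 ⟨s * t, mul_mem hs ht, k + l + m, ?_⟩
  calc 1 * (s * t) = M * s * (M * t) := by
        rw [hM.mul_stabilizer_mul hs, hM.isHermitianPauli.mul_self]
    _ = Complex.I ^ (k + l + m) • pauliString (extString A (xorString p q)) := by
        rw [hk, hl, smul_mul_smul_comm, hm, smul_smul, extString_xorString, pow_add, pow_add]

namespace IsOneUnitState

theorem expVal_re_sq_of_mem_cosetStrings (hψ : K.IsOneUnitState ψ) {p : A → Fin 4}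
    (hp : p ∈ K.cosetStrings A M) :
    (expVal ψ (pauliString (extString A p))).re ^ 2 = ‖expVal ψ M‖ ^ 2 := by
  obtain ⟨s, hs, k, hk⟩ := mem_cosetStrings.1 hp
  rw [← expVal_mul_right_of_fixed (hψ.stab_mulVec hs) M, hk, expVal_smul, norm_mul, norm_pow,
    Complex.norm_I, one_pow, one_mul, expVal_pauliString_re_sq]

theorem mem_cosetStrings_of_expVal_ne_zero (hψ : K.IsOneUnitState ψ) {p : A → Fin 4}
    (h : expVal ψ (pauliString (extString A p)) ≠ 0) :
    p ∈ K.cosetStrings A 1 ∨ p ∈ K.cosetStrings A K.logZ ∨ p ∈ K.cosetStrings A K.logY := by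
  set P := pauliString (extString A p)
  have exists_trace_ne_zero : ∃ M ∈ ({1, K.logZ, K.logY} : Set (Op (Fin L))), ∃ s ∈ K.stabGroup,
      (P * (M * s)).trace ≠ 0 := by
    by_contra! trace_zero
    refine h ?_
    rw [← trace_mul_density]
    refine LinearMap.eqOn_span'
      (f := Matrix.traceLinearMap (Fin L → Fin 2) ℂ ℂ ∘ₗ LinearMap.mulLeft ℂ P) (g := 0) ?_
      hψ.density_mem_span
    rintro _ ⟨M, hM, s, hs, rfl⟩
    exact trace_zero M hM s hs
  obtain ⟨M, hM, s, hs, trace_ne_zero⟩ := exists_trace_ne_zero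
  have mem_of_isLogicalPauli (hMK : K.IsLogicalPauli M) : p ∈ K.cosetStrings A M :=
    mem_cosetStrings.2 ⟨s, hs,
      (hMK.mul_stabilizer hs).isHermitianPauli.isPauli.eq_of_trace_ne_zero trace_ne_zero⟩
  rcases hM with rfl | rfl | rfl
  · exact Or.inl (mem_of_isLogicalPauli K.isLogicalPauli_one)
  · exact Or.inr (Or.inl (mem_of_isLogicalPauli K.isLogicalPauli_logZ))
  · exact Or.inr (Or.inr (mem_of_isLogicalPauli K.isLogicalPauli_logY))

-- The squared expectation values on the three cosets are `1, 1/2, 1/2`, at which `4 q² - 3 q`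
-- takes the values `1, -1/2, -1/2`.
theorem two_mul_card_cosetStrings_one_le (hψ : K.IsOneUnitState ψ)
    (h : 4 * pauliMoment 4 A ψ = 3 * pauliMoment 2 A ψ) :
    2 * (K.cosetStrings A 1).card ≤
      (K.cosetStrings A K.logZ).card + (K.cosetStrings A K.logY).card := by
  classical
  have pointwise (p : A → Fin 4) :
      ((if p ∈ K.cosetStrings A 1 then 1 else 0) -
          1 / 2 * (if p ∈ K.cosetStrings A K.logZ then 1 else 0) -
          1 / 2 * (if p ∈ K.cosetStrings A K.logY then 1 else 0) : ℝ) ≤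
        4 * (expVal ψ (pauliString (extString A p))).re ^ 4 -
          3 * (expVal ψ (pauliString (extString A p))).re ^ 2 := by
    have pow_four (x : ℝ) : x ^ 4 = (x ^ 2) ^ 2 := by ring
    rw [pow_four]
    by_cases h1 : p ∈ K.cosetStrings A 1
    · rw [hψ.expVal_re_sq_of_mem_cosetStrings h1, expVal_one, hψ.1]
      split_ifs <;> norm_num
    by_cases hZ : p ∈ K.cosetStrings A K.logZ
    · rw [hψ.expVal_re_sq_of_mem_cosetStrings hZ, hψ.norm_expVal_logZ_sq]
      split_ifs <;> norm_num
    by_cases hY : p ∈ K.cosetStrings A K.logY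
    · rw [hψ.expVal_re_sq_of_mem_cosetStrings hY, hψ.norm_expVal_logY_sq]
      split_ifs; norm_num
    · have expVal_zero : expVal ψ (pauliString (extString A p)) = 0 := by
        by_contra hne
        exact (hψ.mem_cosetStrings_of_expVal_ne_zero hne).elim h1 (Or.rec hZ hY)
      simp [expVal_zero, h1, hZ, hY]
  have sum_le := Finset.sum_le_sum fun p (_ : p ∈ Finset.univ) => pointwise p
  simp only [Finset.sum_sub_distrib, ← Finset.mul_sum, Finset.sum_boole, Finset.filter_univ_mem]
    at sum_le
  change _ ≤ 4 * pauliMoment 4 A ψ - 3 * pauliMoment 2 A ψ at sum_le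
  exact_mod_cast (by linarith : (2 * (K.cosetStrings A 1).card : ℝ) ≤
    (K.cosetStrings A K.logZ).card + (K.cosetStrings A K.logY).card)

theorem reducible_of_stabilizerEntropy_eq (hψ : K.IsOneUnitState ψ)
    (h : stabilizerEntropy (reduced A (density ψ)) = Real.logb 2 (4 / 3)) :
    K.Reducible A K.logX ∧ K.Reducible A K.logY ∧ K.Reducible A K.logZ := by
  have moments := (stabilizerEntropy_reduced_eq_logb_iff hψ.1 (by norm_num)).1 h
  have card_one_pos : 0 < (K.cosetStrings A 1).card :=
    Finset.card_pos.2 ⟨0, K.zero_mem_cosetStrings_one A⟩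
  have card_sum := hψ.two_mul_card_cosetStrings_one_le (A := A) (by linarith)
  have card_Z_le := K.isLogicalPauli_logZ.card_cosetStrings_le A
  have card_Y_le := K.isLogicalPauli_logY.card_cosetStrings_le A
  have reducible_Y : K.Reducible A K.logY :=
    reducible_of_cosetStrings_nonempty (Finset.card_pos.1 (by omega))
  have reducible_Z : K.Reducible A K.logZ :=
    reducible_of_cosetStrings_nonempty (Finset.card_pos.1 (by omega))
  exact ⟨reducible_Y.logX reducible_Z, reducible_Y, reducible_Z⟩

end IsOneUnitState

end Code

/-! ## The ancilla qubit -/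

section Kron

open scoped Kronecker

variable {κ : Type*}

/-- A bit string on the register and the ancilla `none` is a bit string on the register together
with one more bit. -/
def ancillaEquiv : (Option κ → Fin 2) ≃ (κ → Fin 2) × Fin 2 :=
  Equiv.piOptionEquivProd.trans (Equiv.prodComm _ _)

/-- The operator `M ⊗ N` on the register and the ancilla qubit `none`. -/
def kron (M : Op κ) (N : Matrix (Fin 2) (Fin 2) ℂ) : Op (Option κ) :=
  (M ⊗ₖ N).submatrix ancillaEquiv ancillaEquiv

theorem kron_apply (M : Op κ) (N : Matrix (Fin 2) (Fin 2) ℂ) (x y : Option κ → Fin 2) :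
    kron M N x y = M (fun i => x (some i)) (fun i => y (some i)) * N (x none) (y none) := rfl

theorem kron_conjTranspose (M : Op κ) (N : Matrix (Fin 2) (Fin 2) ℂ) :
    (kron M N)ᴴ = kron Mᴴ Nᴴ := by
  rw [kron, Matrix.conjTranspose_submatrix, Matrix.conjTranspose_kronecker, kron]

theorem kron_add_left (M M' : Op κ) (N : Matrix (Fin 2) (Fin 2) ℂ) :
    kron (M + M') N = kron M N + kron M' N := by
  rw [kron, Matrix.add_kronecker]
  rfl

theorem kron_add_right (M : Op κ) (N N' : Matrix (Fin 2) (Fin 2) ℂ) :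
    kron M (N + N') = kron M N + kron M N' := by
  rw [kron, Matrix.kronecker_add]
  rfl

theorem kron_smul_left (c : ℂ) (M : Op κ) (N : Matrix (Fin 2) (Fin 2) ℂ) :
    kron (c • M) N = c • kron M N := by
  rw [kron, Matrix.smul_kronecker]
  rfl

theorem kron_smul_right (c : ℂ) (M : Op κ) (N : Matrix (Fin 2) (Fin 2) ℂ) :
    kron M (c • N) = c • kron M N := by
  rw [kron, Matrix.kronecker_smul]
  rfl

theorem kron_neg_left (M : Op κ) (N : Matrix (Fin 2) (Fin 2) ℂ) : kron (-M) N = -kron M N := by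
  rw [← neg_one_smul ℂ, kron_smul_left, neg_one_smul]

theorem kron_neg_right (M : Op κ) (N : Matrix (Fin 2) (Fin 2) ℂ) : kron M (-N) = -kron M N := by
  rw [← neg_one_smul ℂ, kron_smul_right, neg_one_smul]

variable [Fintype κ]

theorem kron_one_one : kron (1 : Op κ) 1 = 1 := by
  rw [kron, Matrix.one_kronecker_one, Matrix.submatrix_one_equiv]

theorem kron_mul [DecidableEq κ] (M M' : Op κ) (N N' : Matrix (Fin 2) (Fin 2) ℂ) :
    kron M N * kron M' N' = kron (M * M') (N * N') := by
  rw [kron, kron, Matrix.submatrix_mul_equiv, ← Matrix.mul_kronecker_mul, kron]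

theorem pauliString_option (q : Option κ → Fin 4) :
    pauliString q = kron (pauliString fun i => q (some i)) (pauliMat (q none)) := by
  ext x y
  rw [kron_apply, pauliString, Matrix.of_apply, Fintype.prod_option, mul_comm]
  rfl

end Kron

section WithAncilla

variable {L : ℕ}

theorem withAncilla_comp_ancillaEquiv_symm (φ : (Fin L → Fin 2) → ℂ) (χ : Fin 2 → ℂ)
    (z : (Fin L → Fin 2) × Fin 2) :
    withAncilla φ χ (ancillaEquiv.symm z) = φ z.1 * χ z.2 := rfl

theorem star_withAncilla_dotProduct (φ φ' : (Fin L → Fin 2) → ℂ) (χ χ' : Fin 2 → ℂ) :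
    star (withAncilla φ χ) ⬝ᵥ withAncilla φ' χ' = (star φ ⬝ᵥ φ') * (star χ ⬝ᵥ χ') := by
  rw [dotProduct, ← Equiv.sum_comp ancillaEquiv.symm, Fintype.sum_prod_type, dotProduct,
    dotProduct, Finset.sum_mul_sum]
  simp only [Pi.star_apply, withAncilla_comp_ancillaEquiv_symm, star_mul', mul_mul_mul_comm]

theorem kron_mulVec_withAncilla (M : Op (Fin L)) (N : Matrix (Fin 2) (Fin 2) ℂ)
    (φ : (Fin L → Fin 2) → ℂ) (χ : Fin 2 → ℂ) :
    kron M N *ᵥ withAncilla φ χ = withAncilla (M *ᵥ φ) (N *ᵥ χ) := by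
  funext x
  rw [Matrix.mulVec, dotProduct, ← Equiv.sum_comp ancillaEquiv.symm, Fintype.sum_prod_type,
    withAncilla, Matrix.mulVec, Matrix.mulVec, dotProduct, dotProduct, Finset.sum_mul_sum]
  refine Finset.sum_congr rfl fun y _ => Finset.sum_congr rfl fun b _ => ?_
  rw [withAncilla_comp_ancillaEquiv_symm, mul_mul_mul_comm]
  rfl

theorem expVal_withAncilla_kron (φ : (Fin L → Fin 2) → ℂ) (χ : Fin 2 → ℂ) (M : Op (Fin L))
    (N : Matrix (Fin 2) (Fin 2) ℂ) :
    expVal (withAncilla φ χ) (kron M N) = expVal φ M * (star χ ⬝ᵥ N *ᵥ χ) := by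
  rw [expVal, kron_mulVec_withAncilla, star_withAncilla_dotProduct, expVal]

theorem density_withAncilla (φ : (Fin L → Fin 2) → ℂ) (χ : Fin 2 → ℂ) :
    density (withAncilla φ χ) = kron (density φ) (Matrix.vecMulVec χ (star χ)) := by
  ext x y
  simp only [density, Matrix.vecMulVec_apply, kron_apply, withAncilla, Pi.star_apply, star_mul',
    mul_mul_mul_comm]

end WithAncilla

section InsertNone

/-- A function on `A` and the ancilla is a function on `A` together with a value at the
ancilla. -/
def insertNoneFunEquiv {κ : Type*} (A : Finset κ) :
    (Finset.insertNone A → Fin 4) ≃ (A → Fin 4) × Fin 4 where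
  toFun p := (fun i => p ⟨some i, Finset.some_mem_insertNone.2 i.2⟩,
    p ⟨none, Finset.none_mem_insertNone⟩)
  invFun q := fun i => match i with
    | ⟨none, _⟩ => q.2
    | ⟨some i, h⟩ => q.1 ⟨i, Finset.some_mem_insertNone.1 h⟩
  left_inv p := by
    funext i
    rcases i with ⟨_ | i, h⟩ <;> rfl
  right_inv q := rfl

theorem pauliString_extString_insertNone {κ : Type*} [Fintype κ] [DecidableEq κ] (A : Finset κ)
    (q : A → Fin 4) (a : Fin 4) :
    pauliString (extString (Finset.insertNone A) ((insertNoneFunEquiv A).symm (q, a))) =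
      kron (pauliString (extString A q)) (pauliMat a) := by
  rw [pauliString_option]
  congr 2
  · funext i
    simp only [extString, Finset.some_mem_insertNone]
    rfl
  · simp only [extString, Finset.none_mem_insertNone, dif_pos]
    rfl

/-- The real parts of the expectation values of `1, X, Y, Z` in the one-qubit state `χ`: the Bloch
vector, preceded by the squared norm of `χ`. -/
def blochVector (χ : Fin 2 → ℂ) (a : Fin 4) : ℝ := (star χ ⬝ᵥ pauliMat a *ᵥ χ).re

theorem pauliMoment_withAncilla {L : ℕ} (k : ℕ) (A : Finset (Fin L)) (φ : (Fin L → Fin 2) → ℂ)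
    (χ : Fin 2 → ℂ) :
    pauliMoment k (Finset.insertNone A) (withAncilla φ χ) =
      pauliMoment k A φ * ∑ a, blochVector χ a ^ k := by
  rw [pauliMoment, ← Equiv.sum_comp (insertNoneFunEquiv A).symm, Fintype.sum_prod_type,
    pauliMoment, Finset.sum_mul_sum]
  refine Finset.sum_congr rfl fun q _ => Finset.sum_congr rfl fun a _ => ?_
  rw [pauliString_extString_insertNone, expVal_withAncilla_kron, Complex.mul_re,
    expVal_pauliString_im, zero_mul, sub_zero, mul_pow, blochVector]

end InsertNone

section OneQubitStates

theorem ketT_eq : ketT = ![(√2 : ℂ)⁻¹, (1 + Complex.I) / 2] := by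
  have exp_eq : Complex.exp (Complex.I * Real.pi / 4) = (√2 : ℂ) / 2 * (1 + Complex.I) := by
    rw [show Complex.I * Real.pi / 4 = ((Real.pi / 4 : ℝ) : ℂ) * Complex.I by push_cast; ring,
      Complex.exp_mul_I, ← Complex.ofReal_cos, ← Complex.ofReal_sin, Real.cos_pi_div_four,
      Real.sin_pi_div_four]
    push_cast
    ring
  have sqrt_ne_zero : (√2 : ℂ) ≠ 0 := by simp
  rw [ketT, exp_eq, Matrix.smul_cons, Matrix.smul_cons, Matrix.smul_empty, smul_eq_mul, mul_one,
    smul_eq_mul]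
  field_simp

theorem vecMulVec_ketZero : Matrix.vecMulVec ketZero (star ketZero) =
    (2 : ℂ)⁻¹ • (1 + pauliMat 3) := by
  ext i j
  fin_cases i <;> fin_cases j <;> simp [Matrix.vecMulVec_apply, pauliMat, ketZero]
  norm_num

theorem vecMulVec_ketT : Matrix.vecMulVec ketT (star ketT) =
    (2 : ℂ)⁻¹ • (1 + (√2 : ℂ)⁻¹ • (pauliMat 1 + pauliMat 2)) := by
  rw [ketT_eq]
  ext i j
  fin_cases i <;> fin_cases j <;>
    simp [Matrix.vecMulVec_apply, pauliMat, inv_sqrt_two_mul_self]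
  · ring
  · ring
  · linear_combination -(1 / 4 : ℂ) * Complex.I_sq

theorem blochVector_ketZero : blochVector ketZero = ![1, 0, 0, 1] := by
  funext a
  fin_cases a <;> simp [blochVector, pauliMat, ketZero, dotProduct, Matrix.mulVec]

theorem blochVector_ketT : blochVector ketT = ![1, (√2)⁻¹, (√2)⁻¹, 0] := by
  have inv_sqrt_two_eq : (√2 : ℂ)⁻¹ = ((√2)⁻¹ : ℝ) := by simp
  have inv_sqrt_two_sq : (√2)⁻¹ * (√2)⁻¹ = 1 / 2 := by
    rw [← mul_inv, Real.mul_self_sqrt zero_le_two, one_div]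
  have one_add_I_div_two : (1 + Complex.I) / 2 = ⟨1 / 2, 1 / 2⟩ := by
    apply Complex.ext <;> simp
  funext a
  rw [blochVector, ketT_eq, inv_sqrt_two_eq, one_add_I_div_two]
  generalize (√2)⁻¹ = r at inv_sqrt_two_sq ⊢
  fin_cases a <;> simp [pauliMat, dotProduct, Matrix.mulVec, Fin.sum_univ_two] <;>
    linarith [inv_sqrt_two_sq]

theorem star_ketT_dotProduct_ketT : star ketT ⬝ᵥ ketT = 1 := by
  rw [← dotProduct_comm, ← Matrix.trace_vecMulVec, vecMulVec_ketT]
  simp [trace_pauliMat, Matrix.trace_add]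

theorem star_ketZero_dotProduct_ketZero : star ketZero ⬝ᵥ ketZero = 1 := by
  simp [ketZero, dotProduct, Fin.sum_univ_two]

end OneQubitStates

/-! ## Extraction preserves the moments -/

section Moments

variable {κ : Type*} [Fintype κ] [DecidableEq κ]

theorem IsStabilizerState.expVal_pauliString_eq_zero_or_sq_eq_one {φ : (κ → Fin 2) → ℂ}
    (hφ : IsStabilizerState φ) (p : κ → Fin 4) :
    expVal φ (pauliString p) = 0 ∨ expVal φ (pauliString p) ^ 2 = 1 := by
  obtain ⟨φ_unit, s, hs, s_commute, density_eq⟩ := hφ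
  by_cases hp : ∀ j, Commute (pauliString p) (s j)
  · have commute_density : Commute (pauliString p) (density φ) := by
      rw [density_eq]
      exact (commute_stabProd hp).smul_right _
    right
    rw [sq, ← expVal_mul_of_commute_density φ_unit commute_density, pauliString_mul_self,
      expVal_one, φ_unit]
  · obtain ⟨j, hj⟩ := not_forall.1 hp
    have fixed : s j *ᵥ φ = φ := mulVec_eq_of_mul_density φ_unit <| by
      rw [density_eq, mul_smul_comm, gen_mul_stabProd hs s_commute]
    have anticommute :=
      ((isPauli_pauliString p).commute_or_anticommute (hs j).isPauli).resolve_left hj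
    have expVal_eq_neg := congrArg (expVal φ) anticommute
    rw [expVal_neg, expVal_mul_right_of_fixed fixed,
      expVal_mul_left_of_fixed (hs j).conjTranspose_eq fixed] at expVal_eq_neg
    exact Or.inl (self_eq_neg.1 expVal_eq_neg)

theorem IsStabilizerState.pauliMoment_four {φ : (κ → Fin 2) → ℂ} (hφ : IsStabilizerState φ)
    (S : Finset κ) : pauliMoment 4 S φ = pauliMoment 2 S φ := by
  refine Finset.sum_congr rfl fun p _ => ?_
  have pow_four (x : ℝ) : x ^ 4 = (x ^ 2) ^ 2 := by ring
  rw [pow_four, expVal_pauliString_re_sq, ← norm_pow]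
  rcases hφ.expVal_pauliString_eq_zero_or_sq_eq_one (extString S p) with h | h <;> simp [h]

theorem UnitarilyExtractable.stabilizerEntropy_eq {L : ℕ} {A : Finset (Fin L)}
    {ψ : (Fin L → Fin 2) → ℂ} (hψ : star ψ ⬝ᵥ ψ = 1) (h : UnitarilyExtractable A ψ) :
    stabilizerEntropy (reduced A (density ψ)) = Real.logb 2 (4 / 3) := by
  obtain ⟨U, hU, φ, hφ, output_eq⟩ := h
  have moment_eq {k : ℕ} (hk : Even k) : pauliMoment k A ψ * ∑ a, blochVector ketZero a ^ k =
      pauliMoment k A φ * ∑ a, blochVector ketT a ^ k := by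
    rw [← pauliMoment_withAncilla, ← pauliMoment_withAncilla, ← output_eq,
      hU.pauliMoment_localOp_mulVec hk]
  have moment_two := moment_eq (by decide : Even 2)
  have moment_four := moment_eq (by decide : Even 4)
  have inv_sqrt_two_sq : (√2)⁻¹ ^ 2 = 1 / 2 := by rw [inv_pow, Real.sq_sqrt zero_le_two, one_div]
  have inv_sqrt_two_pow_four : (√2)⁻¹ ^ 4 = 1 / 4 := by
    rw [pow_mul _ 2 2, inv_sqrt_two_sq]; norm_num
  rw [hφ.pauliMoment_four] at moment_four
  simp only [blochVector_ketZero, blochVector_ketT, Fin.sum_univ_four, Matrix.cons_val,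
    inv_sqrt_two_sq, inv_sqrt_two_pow_four] at moment_two moment_four
  rw [stabilizerEntropy_reduced_eq_logb_iff hψ (by norm_num)]
  linarith

end Moments

/-! ## Exchanging an encoded qubit with the ancilla -/

section CZ

variable {R : Type*} [Ring R] [Algebra ℂ R] {u v Q : R}

/-- The controlled-sign gate of two commuting involutions `u` and `v`: it acts as `-1` where both
are `-1`, and as `1` elsewhere. -/
noncomputable def czGate (u v : R) : R := (2 : ℂ)⁻¹ • (1 + u + v - u * v)

theorem map_czGate {R' : Type*} [Ring R'] [Algebra ℂ R'] (f : R →ₐ[ℂ] R') (u v : R) :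
    f (czGate u v) = czGate (f u) (f v) := by
  simp only [czGate, map_smul, map_sub, map_add, map_one, map_mul]

theorem czGate_comm (huv : Commute u v) : czGate u v = czGate v u := by
  rw [czGate, czGate, huv.eq, add_right_comm]

theorem czGate_mul_self (hu : u * u = 1) (hv : v * v = 1) (huv : Commute u v) :
    czGate u v * czGate u v = 1 := by
  have square : (1 + u + v - u * v) * (1 + u + v - u * v) = (4 : ℂ) • 1 := by
    have mul_cancel (x : R) : u * (u * x) = x := by rw [← mul_assoc, hu, one_mul]
    simp only [mul_add, add_mul, mul_sub, sub_mul, one_mul, mul_one, mul_assoc, hu, hv, ← huv.eq,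
      mul_cancel, huv.symm.left_comm]
    module
  rw [czGate, smul_mul_smul_comm, square, smul_smul]
  norm_num

theorem commute_czGate (hu : Commute u Q) (hv : Commute v Q) : Commute (czGate u v) Q :=
  ((((Commute.one_left Q).add_left hu).add_left hv).sub_left (hu.mul_left hv)).smul_left _

theorem czGate_semiconjBy_mul_of_commute_of_anticommute (hu : u * u = 1)
    (huQ : Commute u Q) (hvQ : v * Q = -(Q * v)) : SemiconjBy (czGate u v) Q (u * Q) := by
  have mul_cancel (x : R) : u * (u * x) = x := by rw [← mul_assoc, hu, one_mul]
  simp only [SemiconjBy, czGate, smul_mul_assoc, mul_smul_comm]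
  simp only [mul_add, add_mul, mul_sub, sub_mul, one_mul, mul_one, mul_assoc, hvQ, ← huQ.eq,
    huQ.symm.left_comm, mul_cancel, mul_neg]
  abel_nf

theorem czGate_semiconjBy_neg_mul_of_anticommute (hu : u * u = 1) (hv : v * v = 1)
    (huv : Commute u v) (huQ : u * Q = -(Q * u)) (hvQ : v * Q = -(Q * v)) :
    SemiconjBy (czGate u v) Q (-(u * v * Q)) := by
  have anticommute_left (x : R) : Q * (u * x) = -(u * (Q * x)) := by
    rw [← mul_assoc, ← mul_assoc, huQ, neg_mul, neg_neg]
  have Q_mul_v : Q * v = -(v * Q) := by rw [hvQ, neg_neg]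
  have Q_mul_u : Q * u = -(u * Q) := by rw [huQ, neg_neg]
  have mul_cancel_u (x : R) : u * (u * x) = x := by rw [← mul_assoc, hu, one_mul]
  have mul_cancel_v (x : R) : v * (v * x) = x := by rw [← mul_assoc, hv, one_mul]
  simp only [SemiconjBy, czGate, smul_mul_assoc, mul_smul_comm]
  simp only [mul_add, add_mul, mul_sub, sub_mul, one_mul, mul_one, mul_assoc, neg_mul, mul_neg,
    Q_mul_u, Q_mul_v, anticommute_left, huv.symm.left_comm, mul_cancel_u, mul_cancel_v]
  abel_nf

theorem semiconjBy_symm_of_mul_self {M : Type*} [Monoid M] {g x y : M} (hg : g * g = 1)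
    (h : SemiconjBy g x y) : SemiconjBy g y x := by
  rw [SemiconjBy, ← mul_one (g * y), ← hg, mul_assoc, ← mul_assoc y, ← h.eq, ← mul_assoc,
    ← mul_assoc, hg, one_mul]

variable {κ : Type*} [Fintype κ] [DecidableEq κ]

theorem czGate_conjTranspose {u v : Op κ} (hu : uᴴ = u) (hv : vᴴ = v) (huv : Commute u v) :
    (czGate u v)ᴴ = czGate u v := by
  simp only [czGate, Matrix.conjTranspose_smul, Matrix.conjTranspose_sub,
    Matrix.conjTranspose_add, Matrix.conjTranspose_one, Matrix.conjTranspose_mul, hu, hv, huv.eq,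
    star_inv₀, star_ofNat]

theorem isClifford_czGate {u v : Op κ} (hu : IsHermitianPauli u) (hv : IsHermitianPauli v)
    (huv : Commute u v) : IsClifford (czGate u v) := by
  have hermitian := czGate_conjTranspose hu.conjTranspose_eq hv.conjTranspose_eq huv
  have involutive := czGate_mul_self hu.mul_self hv.mul_self huv
  refine ⟨Matrix.mem_unitaryGroup_iff.2 (by rwa [Matrix.star_eq_conjTranspose, hermitian]),
    fun Q hQ => ?_⟩
  suffices ∃ Q', IsPauli Q' ∧ SemiconjBy (czGate u v) Q Q' by
    obtain ⟨Q', hQ', semiconj⟩ := this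
    rwa [hermitian, semiconj.eq, mul_assoc, involutive, mul_one]
  rcases hu.isPauli.commute_or_anticommute hQ with huQ | huQ <;>
    rcases hv.isPauli.commute_or_anticommute hQ with hvQ | hvQ
  · exact ⟨Q, hQ, commute_czGate huQ hvQ⟩
  · exact ⟨u * Q, hu.isPauli.mul hQ,
      czGate_semiconjBy_mul_of_commute_of_anticommute hu.mul_self huQ hvQ⟩
  · rw [czGate_comm huv]
    exact ⟨v * Q, hv.isPauli.mul hQ,
      czGate_semiconjBy_mul_of_commute_of_anticommute hv.mul_self hvQ huQ⟩
  · exact ⟨-(u * v * Q), ((hu.isPauli.mul hv.isPauli).mul hQ).neg,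
      czGate_semiconjBy_neg_mul_of_anticommute hu.mul_self hv.mul_self huv huQ hvQ⟩

end CZ

section Swap

variable {κ : Type*} [Fintype κ] [DecidableEq κ] {a b S : Op κ}

/-- The gate that exchanges the virtual qubit of the register on which the anticommuting
involutions `a` and `b` act as `X` and `Y` with the ancilla. -/
noncomputable def swapGate (a b : Op κ) : Op (Option κ) :=
  czGate (kron a (pauliMat 1)) (kron b (pauliMat 2))

theorem kron_pauliMat_mul_self (ha : a * a = 1) (j : Fin 4) :
    kron a (pauliMat j) * kron a (pauliMat j) = 1 := by
  rw [kron_mul, ha, pauliMat_mul_self, kron_one_one]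

theorem pauliMat_two_mul_one : pauliMat 2 * pauliMat 1 = -(pauliMat 1 * pauliMat 2) := by
  rw [pauliMat_mul, pauliMat_mul]
  simp [pauliPhase, pow_succ]

theorem smul_pauliMat_one_mul_two : (-Complex.I) • (pauliMat 1 * pauliMat 2) = pauliMat 3 := by
  rw [pauliMat_mul]
  simp [pauliPhase, smul_smul]

theorem commute_kron_of_anticommute (hab : a * b = -(b * a)) :
    Commute (kron a (pauliMat 1)) (kron b (pauliMat 2)) := by
  rw [commute_iff_eq, kron_mul, kron_mul, hab, pauliMat_two_mul_one, kron_neg_left,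
    kron_neg_right]

theorem swapGate_mul_self (ha : a * a = 1) (hb : b * b = 1) (hab : a * b = -(b * a)) :
    swapGate a b * swapGate a b = 1 :=
  czGate_mul_self (kron_pauliMat_mul_self ha 1) (kron_pauliMat_mul_self hb 2)
    (commute_kron_of_anticommute hab)

theorem commute_swapGate (ha : Commute a S) (hb : Commute b S) :
    Commute (swapGate a b) (kron S 1) := by
  refine commute_czGate ?_ ?_ <;>
    rw [commute_iff_eq, kron_mul, kron_mul, mul_one, one_mul]
  · rw [ha.eq]
  · rw [hb.eq]

theorem swapGate_semiconjBy_X (ha : a * a = 1) (hab : a * b = -(b * a)) :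
    SemiconjBy (swapGate a b) (kron a 1) (kron 1 (pauliMat 1)) := by
  have semiconj : SemiconjBy (swapGate a b) (kron a 1) (kron a (pauliMat 1) * kron a 1) := by
    refine czGate_semiconjBy_mul_of_commute_of_anticommute (kron_pauliMat_mul_self ha 1) ?_ ?_
    · rw [commute_iff_eq, kron_mul, kron_mul, mul_one, one_mul]
    · rw [kron_mul, kron_mul, mul_one, one_mul, hab, kron_neg_left, neg_neg]
  rwa [kron_mul, ha, mul_one] at semiconj

theorem swapGate_semiconjBy_Y (hb : b * b = 1) (hab : a * b = -(b * a)) :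
    SemiconjBy (swapGate a b) (kron b 1) (kron 1 (pauliMat 2)) := by
  have semiconj : SemiconjBy (swapGate a b) (kron b 1) (kron b (pauliMat 2) * kron b 1) := by
    rw [swapGate, czGate_comm (commute_kron_of_anticommute hab)]
    refine czGate_semiconjBy_mul_of_commute_of_anticommute (kron_pauliMat_mul_self hb 2) ?_ ?_
    · rw [commute_iff_eq, kron_mul, kron_mul, mul_one, one_mul]
    · rw [kron_mul, kron_mul, mul_one, one_mul, hab, kron_neg_left]
  rwa [kron_mul, hb, mul_one] at semiconj

theorem swapGate_semiconjBy_Z (ha : a * a = 1) (hb : b * b = 1) (hab : a * b = -(b * a)) :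
    SemiconjBy (swapGate a b) (kron 1 (pauliMat 3)) (kron (-Complex.I • (a * b)) 1) := by
  have involutive := swapGate_mul_self ha hb hab
  have semiconj_X := semiconjBy_symm_of_mul_self involutive (swapGate_semiconjBy_X ha hab)
  have semiconj_Y := semiconjBy_symm_of_mul_self involutive (swapGate_semiconjBy_Y hb hab)
  have semiconj := (semiconj_X.mul_right semiconj_Y).smul_right (-Complex.I)
  rwa [kron_mul, kron_mul, one_mul, one_mul, ← kron_smul_right, ← kron_smul_left,
    smul_pauliMat_one_mul_two] at semiconj

theorem IsHermitianPauli.exists_localOp_insertNone {A : Finset κ} {M : Op κ}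
    (hM : IsHermitianPauli M) (hA : IsPauliSupportedOn A M) (j : Fin 4) :
    ∃ N : Op (Finset.insertNone A), IsHermitianPauli N ∧
      localOp (Finset.insertNone A) N = kron M (pauliMat j) := by
  obtain ⟨_, ⟨q, rfl | rfl⟩, rfl⟩ := hM.exists_localOp_eq hA
  · refine ⟨pauliString ((insertNoneFunEquiv A).symm (q, j)), ⟨_, Or.inl rfl⟩, ?_⟩
    rw [localOp_pauliString, localOp_pauliString, pauliString_extString_insertNone]
  · refine ⟨-pauliString ((insertNoneFunEquiv A).symm (q, j)), ⟨_, Or.inr rfl⟩, ?_⟩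
    rw [localOp_neg, localOp_neg, localOp_pauliString, localOp_pauliString,
      pauliString_extString_insertNone, kron_neg_left]

theorem swapGate_conjTranspose (ha : aᴴ = a) (hb : bᴴ = b) (hab : a * b = -(b * a)) :
    (swapGate a b)ᴴ = swapGate a b :=
  czGate_conjTranspose (by rw [kron_conjTranspose, ha, pauliMat_conjTranspose])
    (by rw [kron_conjTranspose, hb, pauliMat_conjTranspose]) (commute_kron_of_anticommute hab)

theorem exists_isClifford_localOp_eq_swapGate {A : Finset κ} (ha : IsHermitianPauli a)
    (hb : IsHermitianPauli b) (haA : IsPauliSupportedOn A a) (hbA : IsPauliSupportedOn A b)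
    (hab : a * b = -(b * a)) :
    ∃ U : Op (Finset.insertNone A), IsClifford U ∧
      localOp (Finset.insertNone A) U = swapGate a b := by
  obtain ⟨u, hu, localOp_u⟩ := ha.exists_localOp_insertNone haA 1
  obtain ⟨v, hv, localOp_v⟩ := hb.exists_localOp_insertNone hbA 2
  have commute_uv : Commute u v := localOp_injective _ <| by
    rw [localOp_mul, localOp_mul, localOp_u, localOp_v, (commute_kron_of_anticommute hab).eq]
  refine ⟨czGate u v, isClifford_czGate hu hv commute_uv, ?_⟩
  rw [← localOpHom_apply, map_czGate, localOpHom_apply, localOpHom_apply, localOp_u, localOp_v,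
    swapGate]

end Swap

section Extraction

variable {L : ℕ} {a b S : Op (Fin L)} {ψ : (Fin L → Fin 2) → ℂ}

theorem density_withAncilla_ketZero {r d : ℂ}
    (hψ : density ψ = d • ((1 + r • (a + b)) * S)) :
    density (withAncilla ψ ketZero) = (d * 2⁻¹) •
      ((1 + r • (kron a 1 + kron b 1)) * kron S 1 * (1 + kron 1 (pauliMat 3))) := by
  rw [density_withAncilla, hψ, vecMulVec_ketZero, kron_smul_left, kron_smul_right, smul_smul,
    ← kron_add_left, ← kron_smul_left r, ← kron_one_one, ← kron_add_left, ← kron_add_right,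
    kron_mul, kron_mul, one_mul, one_mul, mul_one]

theorem kron_vecMulVec_ketT (c : Op (Fin L)) (d : ℂ) :
    kron (d • (S * (1 + c))) (Matrix.vecMulVec ketT (star ketT)) = (d * 2⁻¹) •
      ((1 + (√2 : ℂ)⁻¹ • (kron 1 (pauliMat 1) + kron 1 (pauliMat 2))) * kron S 1 *
        (1 + kron c 1)) := by
  rw [vecMulVec_ketT, kron_smul_left, kron_smul_right, smul_smul,
    ← kron_add_right 1 (pauliMat 1), ← kron_smul_right (√2 : ℂ)⁻¹, ← kron_one_one,
    ← kron_add_left, ← kron_add_right, kron_mul, kron_mul, one_mul, mul_one, mul_one]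

theorem density_swapGate_mulVec {d : ℂ} (ha : IsHermitianPauli a) (hb : IsHermitianPauli b)
    (hab : a * b = -(b * a)) (haS : Commute a S) (hbS : Commute b S)
    (hψ : density ψ = d • ((1 + (√2 : ℂ)⁻¹ • (a + b)) * S)) :
    density (swapGate a b *ᵥ withAncilla ψ ketZero) =
      kron (d • ((1 + -Complex.I • (a * b)) * S)) (Matrix.vecMulVec ketT (star ketT)) := by
  have involutive := swapGate_mul_self ha.mul_self hb.mul_self hab
  have semiconj_S := commute_swapGate haS hbS
  have semiconj_logical : SemiconjBy (swapGate a b) (1 + (√2 : ℂ)⁻¹ • (kron a 1 + kron b 1))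
      (1 + (√2 : ℂ)⁻¹ • (kron 1 (pauliMat 1) + kron 1 (pauliMat 2))) :=
    (SemiconjBy.one_right _).add_right (((swapGate_semiconjBy_X ha.mul_self hab).add_right
      (swapGate_semiconjBy_Y hb.mul_self hab)).smul_right _)
  have semiconj_Z : SemiconjBy (swapGate a b) (1 + kron 1 (pauliMat 3))
      (1 + kron (-Complex.I • (a * b)) 1) :=
    (SemiconjBy.one_right _).add_right (swapGate_semiconjBy_Z ha.mul_self hb.mul_self hab)
  have commute_S : Commute S (1 + -Complex.I • (a * b)) :=
    (Commute.one_right S).add_right ((haS.symm.mul_right hbS.symm).smul_right _)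
  have semiconj := ((semiconj_logical.mul_right semiconj_S).mul_right semiconj_Z).smul_right
    (d * 2⁻¹)
  rw [density_mulVec, density_withAncilla_ketZero hψ, semiconj.eq,
    swapGate_conjTranspose ha.conjTranspose_eq hb.conjTranspose_eq hab, mul_assoc, involutive,
    mul_one, ← commute_S.eq, kron_vecMulVec_ketT]

theorem exists_eq_withAncilla_of_mulVec_eq {χ : Fin 2 → ℂ} {w : (Option (Fin L) → Fin 2) → ℂ}
    (h : kron 1 (Matrix.vecMulVec χ (star χ)) *ᵥ w = w) :
    ∃ φ : (Fin L → Fin 2) → ℂ, w = withAncilla φ χ := by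
  refine ⟨fun x => ∑ b, star (χ b) * w (ancillaEquiv.symm (x, b)), ?_⟩
  funext x
  have kron_entry (y : Fin L → Fin 2) (b : Fin 2) :
      kron 1 (Matrix.vecMulVec χ (star χ)) x (ancillaEquiv.symm (y, b)) =
        (1 : Op (Fin L)) (fun i => x (some i)) y * (χ (x none) * star (χ b)) := rfl
  conv_lhs => rw [← h]
  rw [Matrix.mulVec, dotProduct, ← Equiv.sum_comp ancillaEquiv.symm, Fintype.sum_prod_type,
    Fintype.sum_eq_single fun i => x (some i)]
  · simp only [kron_entry, withAncilla, Finset.sum_mul, Matrix.one_apply_eq]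
    exact Finset.sum_congr rfl fun b _ => by ring
  · intro y hy
    simp only [kron_entry, Matrix.one_apply_ne' hy, zero_mul, Finset.sum_const_zero]

theorem kron_left_injective {M M' : Op (Fin L)} {N : Matrix (Fin 2) (Fin 2) ℂ} (hN : N ≠ 0)
    (h : kron M N = kron M' N) : M = M' := by
  obtain ⟨i, j, hij⟩ : ∃ i j, N i j ≠ 0 := by
    contrapose! hN
    exact Matrix.ext hN
  ext x y
  exact mul_right_cancel₀ hij
    (congrFun₂ h (ancillaEquiv.symm (x, i)) (ancillaEquiv.symm (y, j)))

theorem exists_swapGate_mulVec_eq {d : ℂ} (ha : IsHermitianPauli a) (hb : IsHermitianPauli b)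
    (hab : a * b = -(b * a)) (haS : Commute a S) (hbS : Commute b S) (hψ : star ψ ⬝ᵥ ψ = 1)
    (density_eq : density ψ = d • ((1 + (√2 : ℂ)⁻¹ • (a + b)) * S)) :
    ∃ φ, swapGate a b *ᵥ withAncilla ψ ketZero = withAncilla φ ketT ∧ star φ ⬝ᵥ φ = 1 ∧
      density φ = d • ((1 + -Complex.I • (a * b)) * S) := by
  have output_density := density_swapGate_mulVec ha hb hab haS hbS density_eq
  have output_unit : star (swapGate a b *ᵥ withAncilla ψ ketZero) ⬝ᵥ
      (swapGate a b *ᵥ withAncilla ψ ketZero) = 1 := by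
    rw [Matrix.star_mulVec, Matrix.dotProduct_mulVec, Matrix.vecMul_vecMul,
      swapGate_conjTranspose ha.conjTranspose_eq hb.conjTranspose_eq hab,
      swapGate_mul_self ha.mul_self hb.mul_self hab, Matrix.vecMul_one,
      star_withAncilla_dotProduct, hψ, star_ketZero_dotProduct_ketZero, one_mul]
  have vecMulVec_mul_self : Matrix.vecMulVec ketT (star ketT) * Matrix.vecMulVec ketT (star ketT) =
      Matrix.vecMulVec ketT (star ketT) := by
    rw [Matrix.vecMulVec_mul_vecMulVec, star_ketT_dotProduct_ketT, one_smul]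
  obtain ⟨φ, output_eq⟩ := exists_eq_withAncilla_of_mulVec_eq <|
    mulVec_eq_of_mul_density output_unit
      (N := kron 1 (Matrix.vecMulVec ketT (star ketT))) <| by
        rw [output_density, kron_mul, one_mul, vecMulVec_mul_self]
  rw [output_eq, star_withAncilla_dotProduct, star_ketT_dotProduct_ketT, mul_one] at output_unit
  rw [output_eq, density_withAncilla] at output_density
  have vecMulVec_ne_zero : Matrix.vecMulVec ketT (star ketT) ≠ 0 := fun h => by
    have trace_eq_zero := congrArg Matrix.trace h
    rw [Matrix.trace_vecMulVec, dotProduct_comm, star_ketT_dotProduct_ketT,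
      Matrix.trace_zero] at trace_eq_zero
    exact one_ne_zero trace_eq_zero
  exact ⟨φ, output_eq, output_unit, kron_left_injective vecMulVec_ne_zero output_density⟩

end Extraction

namespace Code

variable {L : ℕ} {K : Code L} {A : Finset (Fin L)} {ψ : (Fin L → Fin 2) → ℂ}

theorem IsLogicalPauli.isStabilizerState {c : Op (Fin L)} (hc : K.IsLogicalPauli c)
    (hψ : star ψ ⬝ᵥ ψ = 1)
    (density_eq : density ψ = ((2 : ℂ) ^ L)⁻¹ • ((1 + c) * stabProd K.gen)) :
    IsStabilizerState ψ := by
  have card_eq : L - 1 + 1 = Fintype.card (Fin L) := by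
    rw [Nat.sub_add_cancel K.pos, Fintype.card_fin]
  suffices ∃ s : Fin (L - 1 + 1) → Op (Fin L), (∀ j, IsHermitianPauli (s j)) ∧
      (∀ i j, Commute (s i) (s j)) ∧ density ψ = ((2 : ℂ) ^ (L - 1 + 1))⁻¹ • stabProd s by
    rw [IsStabilizerState, ← card_eq]
    exact ⟨hψ, this⟩
  refine ⟨Fin.cons c K.gen, Fin.cases hc.isHermitianPauli K.gen_pauli,
    Fin.cases (Fin.cases (Commute.refl c) hc.commute_gen)
      fun i => Fin.cases (hc.commute_gen i).symm (K.gen_commute i), ?_⟩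
  rw [stabProd_cons, density_eq, card_eq, Fintype.card_fin]

theorem IsOneUnitState.exists_representatives (hψ : K.IsOneUnitState ψ)
    (hY : K.Reducible A K.logY) (hZ : K.Reducible A K.logZ) :
    ∃ a b, K.IsLogicalPauli a ∧ K.IsLogicalPauli b ∧ IsPauliSupportedOn A a ∧
      IsPauliSupportedOn A b ∧ a * b = -(b * a) ∧
      density ψ = ((2 : ℂ) ^ L)⁻¹ • ((1 + (√2 : ℂ)⁻¹ • (a + b)) * stabProd K.gen) := by
  obtain ⟨s, hs, hsA⟩ := hZ
  obtain ⟨t, ht, htA⟩ := hY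
  have commute_st : Commute s t := (isLogicalPauli_of_mem_stabGroup hs).commute_of_mem_stabGroup ht
  refine ⟨K.logZ * s, -(K.logY * t), K.isLogicalPauli_logZ.mul_stabilizer hs,
    (K.isLogicalPauli_logY.mul_stabilizer ht).neg, hsA, htA.neg, ?_, ?_⟩
  · rw [mul_neg, neg_mul, K.isLogicalPauli_logY.mul_stabilizer_mul hs,
      K.isLogicalPauli_logZ.mul_stabilizer_mul ht, K.logZ_mul_logY, commute_st.eq, neg_mul]
  · have absorb : (K.logZ * s + -(K.logY * t)) * stabProd K.gen =
        (K.logZ - K.logY) * stabProd K.gen := by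
      rw [add_mul, neg_mul, mul_assoc, mul_assoc, mul_stabProd_of_mem_stabGroup hs,
        mul_stabProd_of_mem_stabGroup ht, ← sub_eq_add_neg, ← sub_mul]
    rw [hψ.density_eq, logW, add_mul, add_mul, smul_mul_assoc, smul_mul_assoc, absorb]

theorem IsOneUnitState.unitarilyExtractable (hψ : K.IsOneUnitState ψ)
    (hY : K.Reducible A K.logY) (hZ : K.Reducible A K.logZ) : UnitarilyExtractable A ψ := by
  obtain ⟨a, b, ha, hb, haA, hbA, hab, density_ψ⟩ := hψ.exists_representatives hY hZ
  obtain ⟨U, hU, localOp_U⟩ := exists_isClifford_localOp_eq_swapGate ha.isHermitianPauli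
    hb.isHermitianPauli haA hbA hab
  obtain ⟨φ, output_eq, φ_unit, density_φ⟩ := exists_swapGate_mulVec_eq ha.isHermitianPauli
    hb.isHermitianPauli hab (commute_stabProd ha.commute_gen) (commute_stabProd hb.commute_gen)
    hψ.1 density_ψ
  have logical_c : K.IsLogicalPauli (-Complex.I • (a * b)) := by
    rw [neg_smul]
    exact (ha.I_smul_mul_of_anticommute hb hab).neg
  exact ⟨U, hU, φ, logical_c.isStabilizerState φ_unit density_φ, localOp_U ▸ output_eq⟩

end Code

end QubitMagic

theorem mainTheorem3 (L : ℕ) (K : QubitMagic.Code L) (ψ : (Fin L → Fin 2) → ℂ)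
    (hψ : K.IsOneUnitState ψ) (A : Finset (Fin L)) :
    List.TFAE
      [QubitMagic.stabilizerEntropy (QubitMagic.reduced A (QubitMagic.density ψ)) =
          Real.logb 2 (4 / 3),
        K.Reducible A K.logX ∧ K.Reducible A K.logY ∧ K.Reducible A K.logZ,
        QubitMagic.UnitarilyExtractable A ψ] := by
  tfae_have 1 → 2 := hψ.reducible_of_stabilizerEntropy_eq
  tfae_have 2 → 3 := fun ⟨_, hY, hZ⟩ => hψ.unitarilyExtractable hY hZ
  tfae_have 3 → 1 := fun h => h.stabilizerEntropy_eq hψ.1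
  tfae_finish
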